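/- Let $\pi$ be a proper subset of the set of all primes. Write $m\in\pi'$ if $m$ is a positive integer none of whose prime divisors lies in $\pi$, and let $\mathbb{Z}_\pi=\{a/b\in\mathbb{Q} : a\in\mathbb{Z},\ b\in\pi'\}$. For a group $G$ and $x\in G$ put $D_G(x)=\{g\in G : C_G(x)\cap C_G(x)^g\neq 1\}$. The class $\mathcal{P}_\pi$ consists of the groups $G$ such that (i) the map $g\mapsto g^m$ is injective on $G$ for every $m\in\pi'$; (ii) whenever $x\in G$ has no $m$-th root in $G$ for some $m\in\pi'$, the group $C_G(x)$ is torsion-free and either (a) $D_G(x)=C_G(x)$, or (b) $D_G(x)$ is a subgroup with $|D_G(x):C_G(x)|=2$ and $C_G(x)$ is isomorphic to a subgroup of the additive group $\mathbb{Z}_\pi$. Let $G\in\mathcal{P}_\pi$ and let $x\in G$ have no $m$-th root in $G$ for some $m\in\pi'$. Put $C=C_G(x)$ and $D=D_G(x)$. (a) Suppose $D=C$. Let $R=\{g\in C : g^b=x^a \text{ for some } a\in\mathbb{Z},\ b\in\pi'\}$, a central subgroup of $C$, let $i:R\to\mathbb{Z}_\pi$ be the monomorphism sending $g$ with $g^b=x^a$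 to $a/b$ (so $i(x)=1$), and let $P=(C\times\mathbb{Z}_\pi)/\{(y,i(y^{-1})) : y\in R\}$ be the central product of $C$ and $\mathbb{Z}_\pi$ over $R$. Then the free product with amalgamation $K=G*_D P$ lies in $\mathcal{P}_\pi$. (b) Suppose $D$ is a subgroup with $|D:C|=2$. Then there is $x_0\in G$ with $C_G(x_0)=C$ that has no $m$-th root in $G$ for some $m\in\pi'$ and for which there is a monomorphism $C\to\mathbb{Z}_\pi$ sending $x_0$ to $1$; so, replacing $x$ by $x_0$, one may assume that there is a monomorphism $i:C\to\mathbb{Z}_\pi$ with $i(x)=1$. For $x$ and any such $i$, let $D$ act on $\mathbb{Z}_\pi$ by the action that extends, through $i$, the conjugation action of $D$ on $C$ (that is, $d\in D$ acts as multiplication by $i(dxd^{-1})$), and let $P=(D\ltimes\mathbb{Z}_\pi)/\{(y,i(y^{-1})) : y\in C\}$. Then the free product with amalgamation $K=G*_D P$ lies in $\mathcal{P}_\pi$. -/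

import Mathlib

universe u

namespace PiLocal

/-- `m ∈ π'`: `m` is a positive integer none of whose prime divisors lies in `π`. -/
def IsPrimeTo (π : Set Nat.Primes) (m : ℕ) : Prop :=
  m ≠ 0 ∧ ∀ p : Nat.Primes, (p : ℕ) ∣ m → p ∉ π

theorem isPrimeTo_one (π : Set Nat.Primes) : IsPrimeTo π 1 :=
  ⟨one_ne_zero, fun p hp => absurd (Nat.dvd_one.1 hp) p.2.ne_one⟩

theorem IsPrimeTo.mul {π : Set Nat.Primes} {m n : ℕ} (hm : IsPrimeTo π m) (hn : IsPrimeTo π n) :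
    IsPrimeTo π (m * n) :=
  ⟨mul_ne_zero hm.1 hn.1, fun p hp => ((p.2.dvd_mul).1 hp).elim (hm.2 p) (hn.2 p)⟩

/-- The ring `ℤ_π` of rational numbers `a / b` with `b ∈ π'`. Its additive group, written
multiplicatively, is `Multiplicative (localInt π)`. -/
def localInt (π : Set Nat.Primes) : Subring ℚ where
  carrier := {r | ∃ b : ℕ, IsPrimeTo π b ∧ ∃ a : ℤ, r = (a : ℚ) / (b : ℚ)}
  zero_mem' := ⟨1, isPrimeTo_one π, 0, by simp⟩
  one_mem' := ⟨1, isPrimeTo_one π, 1, by simp⟩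
  neg_mem' := by
    rintro _ ⟨b, hb, a, rfl⟩
    exact ⟨b, hb, -a, by push_cast; ring⟩
  add_mem' := by
    rintro _ _ ⟨b, hb, a, rfl⟩ ⟨d, hd, c, rfl⟩
    have h1 : (b : ℚ) ≠ 0 := Nat.cast_ne_zero.2 hb.1
    have h2 : (d : ℚ) ≠ 0 := Nat.cast_ne_zero.2 hd.1
    exact ⟨b * d, hb.mul hd, a * d + b * c, by push_cast; field_simp⟩
  mul_mem' := by
    rintro _ _ ⟨b, hb, a, rfl⟩ ⟨d, hd, c, rfl⟩
    exact ⟨b * d, hb.mul hd, a * c, by push_cast; rw [div_mul_div_comm]⟩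

/-- `G` is a `U_π`-group: `g ↦ g ^ m` is injective for every `m ∈ π'`. -/
def IsUGroup (π : Set Nat.Primes) (G : Type u) [Group G] : Prop :=
  ∀ m : ℕ, IsPrimeTo π m → Function.Injective (fun g : G => g ^ m)

/-- `x` has no `m`-th root in `G`, for some `m ∈ π'`. -/
def LacksRoot (π : Set Nat.Primes) {G : Type u} [Group G] (x : G) : Prop :=
  ∃ m : ℕ, IsPrimeTo π m ∧ ∀ y : G, y ^ m ≠ x

/-- The centralizer `C_G(x)`. -/
abbrev cent {G : Type u} [Group G] (x : G) : Subgroup G := Subgroup.centralizer ({x} : Set G)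

/-- The set `D_G(x)` of all `g ∈ G` with `C_G(x) ∩ C_G(x)^g ≠ 1`, where `C^g = g⁻¹ C g`. -/
def dSet {G : Type u} [Group G] (x : G) : Set G :=
  {g | cent x ⊓ (cent x).map (MulAut.conj g⁻¹).toMonoidHom ≠ ⊥}

/-- `D_G(x)` is the subgroup `D`, and `|D : C_G(x)| = 2`. -/
structure IndexTwo {G : Type u} [Group G] (x : G) (D : Subgroup G) : Prop where
  coe_eq : (D : Set G) = dSet x
  relIndex_eq : (cent x).relIndex D = 2

/-- The class `𝒫_π`. -/
structure InP (π : Set Nat.Primes) (G : Type u) [Group G] : Prop where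
  isUGroup : IsUGroup π G
  cond : ∀ x : G, LacksRoot π x →
    (∀ c ∈ cent x, IsOfFinOrder c → c = 1) ∧
    (dSet x = (cent x : Set G) ∨
      ((∃ D : Subgroup G, IndexTwo x D) ∧
        ∃ i : cent x →* Multiplicative (localInt π), Function.Injective i))

section Amalgam

/-- The two factors of the free product with amalgamation. -/
abbrev amalgamFactor (G P : Type u) : Bool → Type u
  | false => G
  | true => P

instance amalgamFactorGroup (G P : Type u) [Group G] [Group P] :
    ∀ b : Bool, Group (amalgamFactor G P b)
  | false => inferInstanceAs (Group G)
  | true => inferInstanceAs (Group P)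

/-- The two homomorphisms from the amalgamated subgroup into the factors. -/
def amalgamMap {G P D : Type u} [Group G] [Group P] [Group D] (f : D →* G) (g : D →* P) :
    ∀ b : Bool, D →* amalgamFactor G P b
  | false => f
  | true => g

/-- The generalized free product `G *_D P` along `f : D → G` and `g : D → P`. -/
abbrev Amalgam {G P D : Type u} [Group G] [Group P] [Group D] (f : D →* G) (g : D →* P) : Type u :=
  Monoid.PushoutI (amalgamMap f g)

end Amalgam

section Basics

variable {π : Set Nat.Primes} {G : Type u} [Group G] {x : G}

theorem self_mem_cent (x : G) : x ∈ cent x :=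
  Subgroup.mem_centralizer_singleton_iff.2 rfl

theorem LacksRoot.ne_one (hx : LacksRoot π x) : x ≠ 1 := by
  rintro rfl
  obtain ⟨m, -, h⟩ := hx
  exact h 1 (one_pow m)

theorem InP.not_isOfFinOrder (hG : InP π G) (hx : LacksRoot π x) : ¬ IsOfFinOrder x :=
  fun h => hx.ne_one ((hG.cond x hx).1 x (self_mem_cent x) h)

theorem IsUGroup.eq_of_pow {m : ℕ} (hU : IsUGroup π G) (hm : IsPrimeTo π m) {g h : G}
    (e : g ^ m = h ^ m) : g = h :=
  hU m hm e

theorem IsUGroup.commute_of_pow {b : ℕ} {a : ℤ} (hU : IsUGroup π G) (hb : IsPrimeTo π b)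
    {g c : G} (e : g ^ b = x ^ a) (hc : c ∈ cent x) : Commute c g := by
  have h1 : Commute c x := Subgroup.mem_centralizer_singleton_iff.1 hc
  have h2 : (c * g * c⁻¹) ^ b = g ^ b := by
    rw [conj_pow, e, (h1.zpow_right a).eq, mul_inv_cancel_right]
  have h3 := hU.eq_of_pow hb h2
  exact mul_inv_eq_iff_eq_mul.1 h3

end Basics

section CentralProduct

variable {π : Set Nat.Primes} {G : Type u} [Group G]

/-- `R = {g ∈ C_G(x) | g = x ^ (a / b), b ∈ π'}`, where `g = x ^ (a / b)` means
`g ^ b = x ^ a`. -/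
def rootSubgroup (hU : IsUGroup π G) (x : G) : Subgroup (cent x) where
  carrier := {g | ∃ b : ℕ, IsPrimeTo π b ∧ ∃ a : ℤ, (g : G) ^ b = x ^ a}
  one_mem' := ⟨1, isPrimeTo_one π, 0, by simp⟩
  inv_mem' := by
    rintro g ⟨b, hb, a, h⟩
    exact ⟨b, hb, -a, by simp [h]⟩
  mul_mem' := by
    rintro g h ⟨b, hb, a, e⟩ ⟨d, hd, c, e'⟩
    refine ⟨b * d, hb.mul hd, a * d + c * b, ?_⟩
    have hc : Commute (g : G) (h : G) := hU.commute_of_pow hd e' g.2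
    rw [Subgroup.coe_mul, hc.mul_pow, pow_mul, e, mul_comm b d, pow_mul, e', zpow_add,
      zpow_mul, zpow_mul, zpow_natCast, zpow_natCast]

theorem exponent_unique {x : G} (hx : ¬ IsOfFinOrder x) {g : G} {b d : ℕ} {a c : ℤ}
    (hb : IsPrimeTo π b) (hd : IsPrimeTo π d) (e : g ^ b = x ^ a) (e' : g ^ d = x ^ c) :
    (a : ℚ) / (b : ℚ) = (c : ℚ) / (d : ℚ) := by
  have h : x ^ (a * d) = x ^ (c * b) := by
    rw [zpow_mul, zpow_mul, zpow_natCast, zpow_natCast, ← e, ← e', ← pow_mul, ← pow_mul,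
      mul_comm]
  have h' : a * d = c * b := injective_zpow_iff_not_isOfFinOrder.2 hx h
  rw [div_eq_div_iff (Nat.cast_ne_zero.2 hb.1) (Nat.cast_ne_zero.2 hd.1)]
  exact_mod_cast h'

/-- The exponent `a / b ∈ ℤ_π` of an element `g = x ^ (a / b)` of `R`. -/
noncomputable def exponentVal (hU : IsUGroup π G) {x : G} (g : rootSubgroup hU x) : localInt π :=
  ⟨(g.2.choose_spec.2.choose : ℚ) / (g.2.choose : ℚ),
    g.2.choose, g.2.choose_spec.1, g.2.choose_spec.2.choose, rfl⟩

theorem exponentVal_eq (hU : IsUGroup π G) {x : G} (hx : ¬ IsOfFinOrder x)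
    (g : rootSubgroup hU x) {b : ℕ} {a : ℤ} (hb : IsPrimeTo π b)
    (e : ((g : cent x) : G) ^ b = x ^ a) : (exponentVal hU g : ℚ) = (a : ℚ) / (b : ℚ) :=
  exponent_unique hx g.2.choose_spec.1 hb g.2.choose_spec.2.choose_spec e

/-- The monomorphism `i : R → ℤ_π`, `x ^ (a / b) ↦ a / b`, which sends `x` to `1`. -/
noncomputable def exponentHom (hU : IsUGroup π G) {x : G} (hx : ¬ IsOfFinOrder x) :
    rootSubgroup hU x →* Multiplicative (localInt π) :=
  MonoidHom.mk' (fun g => Multiplicative.ofAdd (exponentVal hU g)) (by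
    intro g h
    rw [← ofAdd_add]
    refine congrArg Multiplicative.ofAdd (Subtype.ext ?_)
    obtain ⟨b, hb, a, e⟩ := g.2
    obtain ⟨d, hd, c, e'⟩ := h.2
    have hc : Commute ((g : cent x) : G) ((h : cent x) : G) :=
      hU.commute_of_pow hd e' (g : cent x).2
    have e'' : (((g * h : rootSubgroup hU x) : cent x) : G) ^ (b * d) = x ^ (a * d + c * b) := by
      rw [Subgroup.coe_mul, Subgroup.coe_mul, hc.mul_pow, pow_mul, e, mul_comm b d, pow_mul, e',
        zpow_add, zpow_mul, zpow_mul, zpow_natCast, zpow_natCast]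
    have h1 : (b : ℚ) ≠ 0 := Nat.cast_ne_zero.2 hb.1
    have h2 : (d : ℚ) ≠ 0 := Nat.cast_ne_zero.2 hd.1
    rw [Subring.coe_add, exponentVal_eq hU hx _ (hb.mul hd) e'', exponentVal_eq hU hx g hb e,
      exponentVal_eq hU hx h hd e']
    push_cast
    field_simp)

/-- The subgroup `A = {(y, i(y⁻¹)) | y ∈ R}` of `C_G(x) × ℤ_π`. -/
noncomputable def centralKernel (hU : IsUGroup π G) {x : G} (hx : ¬ IsOfFinOrder x) :
    Subgroup (cent x × Multiplicative (localInt π)) where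
  carrier := {p | ∃ y : rootSubgroup hU x, p = ((y : cent x), exponentHom hU hx y⁻¹)}
  one_mem' := ⟨1, by simp [Prod.ext_iff]⟩
  inv_mem' := by
    rintro _ ⟨y, rfl⟩
    exact ⟨y⁻¹, by simp⟩
  mul_mem' := by
    rintro _ _ ⟨y, rfl⟩ ⟨z, rfl⟩
    exact ⟨y * z, by simp [mul_comm]⟩

instance centralKernel_normal (hU : IsUGroup π G) {x : G} (hx : ¬ IsOfFinOrder x) :
    (centralKernel hU hx).Normal where
  conj_mem := by
    rintro _ ⟨y, rfl⟩ ⟨c, z⟩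
    refine ⟨y, Prod.ext (Subtype.ext ?_) ?_⟩
    · obtain ⟨b, hb, a, e⟩ := y.2
      have h : Commute (c : G) ((y : cent x) : G) := hU.commute_of_pow hb e c.2
      simp [h.eq]
    · simp [mul_comm z]

/-- The central product `P` of `C_G(x)` and `ℤ_π` over `R`. -/
abbrev CentralProd (hU : IsUGroup π G) {x : G} (hx : ¬ IsOfFinOrder x) : Type u :=
  (cent x × Multiplicative (localInt π)) ⧸ centralKernel hU hx

/-- The natural embedding of `C_G(x)` into the central product. -/
noncomputable def centralEmb (hU : IsUGroup π G) {x : G} (hx : ¬ IsOfFinOrder x) :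
    cent x →* CentralProd hU hx :=
  (QuotientGroup.mk' (centralKernel hU hx)).comp
    (MonoidHom.inl (cent x) (Multiplicative (localInt π)))

/-- `K = G *_D P`, where `D = C_G(x)` and `P` is the central product. -/
abbrev CentralK (hG : InP π G) {x : G} (hx : LacksRoot π x) : Type u :=
  Amalgam (cent x).subtype (centralEmb hG.isUGroup (hG.not_isOfFinOrder hx))

end CentralProduct

section SemidirectProd

variable {π : Set Nat.Primes} {G : Type u} [Group G] {x : G} {D : Subgroup G}

theorem IndexTwo.cent_le (h : IndexTwo x D) : cent x ≤ D := by
  have h1 : (1 : G) ∈ dSet x := by rw [← h.coe_eq]; exact D.one_mem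
  have h2 : cent x ≠ ⊥ := fun e => h1 (by rw [e]; simp)
  intro g hg
  have : g ∈ dSet x := by
    intro e
    apply h2
    rw [eq_bot_iff, ← e]
    intro c hc
    refine ⟨hc, g * c * g⁻¹, mul_mem (mul_mem hg hc) (inv_mem hg), ?_⟩
    simp [mul_assoc]
  rwa [← h.coe_eq] at this

theorem IndexTwo.conj_mem (h : IndexTwo x D) (d : D) (c : cent x) :
    (d : G) * c * (d : G)⁻¹ ∈ cent x := by
  have hn : ((cent x).subgroupOf D).Normal := Subgroup.normal_of_index_eq_two h.relIndex_eq
  exact hn.conj_mem ⟨c, h.cent_le c.2⟩ c.2 d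

/-- The conjugation action of `D` on `C_G(x)`. -/
def conjHom (h : IndexTwo x D) (d : D) : cent x →* cent x where
  toFun c := ⟨(d : G) * c * (d : G)⁻¹, h.conj_mem d c⟩
  map_one' := Subtype.ext (by simp)
  map_mul' c c' := Subtype.ext (by simp [mul_assoc])

/-- The value of `i : C_G(x) → ℤ_π` as an element of the ring `ℤ_π`. -/
def ringVal (i : cent x →* Multiplicative (localInt π)) (c : cent x) : localInt π :=
  Multiplicative.toAdd (i c)

theorem ringVal_hom (i : cent x →* Multiplicative (localInt π)) (hi : Function.Injective i)
    (hx : i ⟨x, self_mem_cent x⟩ = Multiplicative.ofAdd 1) (f : cent x →* cent x) (c : cent x) :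
    ringVal i (f c) = ringVal i (f ⟨x, self_mem_cent x⟩) * ringVal i c := by
  obtain ⟨b, hb, a, e⟩ := (ringVal i c).2
  have h1 : (b : ℚ) ≠ 0 := Nat.cast_ne_zero.2 hb.1
  have key : c ^ b = (⟨x, self_mem_cent x⟩ : cent x) ^ a := by
    apply hi
    rw [map_pow, map_zpow, hx]
    apply Multiplicative.toAdd.injective
    apply Subtype.ext
    rw [toAdd_pow, toAdd_zpow, toAdd_ofAdd]
    change ((b • ringVal i c : localInt π) : ℚ) = _
    push_cast
    rw [e]
    simp
    field_simp
  have h2 := congrArg (fun y => ringVal i (f y)) key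
  simp only [ringVal, map_pow, map_zpow, toAdd_pow, toAdd_zpow] at h2
  have h3 := congrArg (Subtype.val : localInt π → ℚ) h2
  push_cast at h3
  apply Subtype.ext
  rw [Subring.coe_mul, e]
  simp only [nsmul_eq_mul, zsmul_eq_mul] at h3
  simp only [ringVal]
  field_simp
  linarith

/-- The homomorphism `D → ℤ_π` (multiplicative monoid), `d ↦ i(d x d⁻¹)`. -/
def scaleHom (h : IndexTwo x D) (i : cent x →* Multiplicative (localInt π))
    (hi : Function.Injective i) (hx : i ⟨x, self_mem_cent x⟩ = Multiplicative.ofAdd 1) :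
    D →* localInt π where
  toFun d := ringVal i (conjHom h d ⟨x, self_mem_cent x⟩)
  map_one' := by
    have : conjHom h 1 ⟨x, self_mem_cent x⟩ = ⟨x, self_mem_cent x⟩ :=
      Subtype.ext (by simp [conjHom])
    rw [this, ringVal, hx, toAdd_ofAdd]
  map_mul' d e := by
    have : conjHom h (d * e) ⟨x, self_mem_cent x⟩ =
        conjHom h d (conjHom h e ⟨x, self_mem_cent x⟩) :=
      Subtype.ext (by simp [conjHom, mul_assoc])
    rw [this, ringVal_hom i hi hx]

/-- The action of `D` on `ℤ_π` induced by conjugation on `C_G(x)`: the element `d` multiplies by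
`i(d x d⁻¹)`. It is characterized by `inducedAction_apply`. -/
def inducedAction (h : IndexTwo x D) (i : cent x →* Multiplicative (localInt π))
    (hi : Function.Injective i) (hx : i ⟨x, self_mem_cent x⟩ = Multiplicative.ofAdd 1) :
    D →* MulAut (Multiplicative (localInt π)) :=
  (MulAutMultiplicative (localInt π)).symm.toMonoidHom.comp
    (AddAut.mulLeft.comp (scaleHom h i hi hx).toHomUnits)

theorem inducedAction_def (h : IndexTwo x D) (i : cent x →* Multiplicative (localInt π))
    (hi : Function.Injective i) (hx : i ⟨x, self_mem_cent x⟩ = Multiplicative.ofAdd 1)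
    (d : D) (z : Multiplicative (localInt π)) :
    inducedAction h i hi hx d z =
      Multiplicative.ofAdd (scaleHom h i hi hx d * Multiplicative.toAdd z) :=
  rfl

theorem inducedAction_apply (h : IndexTwo x D) (i : cent x →* Multiplicative (localInt π))
    (hi : Function.Injective i) (hx : i ⟨x, self_mem_cent x⟩ = Multiplicative.ofAdd 1)
    (d : D) (c : cent x) :
    inducedAction h i hi hx d (i c) = i (conjHom h d c) := by
  rw [inducedAction_def]
  exact (congrArg Multiplicative.ofAdd (ringVal_hom i hi hx (conjHom h d) c)).symm

theorem inducedAction_cent (h : IndexTwo x D) (i : cent x →* Multiplicative (localInt π))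
    (hi : Function.Injective i) (hx : i ⟨x, self_mem_cent x⟩ = Multiplicative.ofAdd 1)
    (d : D) (hd : (d : G) ∈ cent x) (z : Multiplicative (localInt π)) :
    inducedAction h i hi hx d z = z := by
  have h1 : conjHom h d ⟨x, self_mem_cent x⟩ = ⟨x, self_mem_cent x⟩ := by
    refine Subtype.ext ?_
    have h2 : (d : G) * x = x * d := Subgroup.mem_centralizer_singleton_iff.1 hd
    simp [conjHom, h2]
  have h2 : scaleHom h i hi hx d = 1 := by
    change ringVal i (conjHom h d ⟨x, self_mem_cent x⟩) = 1
    rw [h1, ringVal, hx, toAdd_ofAdd]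
  rw [inducedAction_def, h2, one_mul, ofAdd_toAdd]

/-- The subgroup `A = {(y, i(y⁻¹)) | y ∈ C_G(x)}` of `D ⋉ ℤ_π`. In the code the normal factor
`ℤ_π` is the left component. -/
def semidirectKernel (h : IndexTwo x D) (i : cent x →* Multiplicative (localInt π))
    (hi : Function.Injective i) (hx : i ⟨x, self_mem_cent x⟩ = Multiplicative.ofAdd 1) :
    Subgroup (Multiplicative (localInt π) ⋊[inducedAction h i hi hx] D) where
  carrier := {p | ∃ y : cent x, p = ⟨i y⁻¹, ⟨y, h.cent_le y.2⟩⟩}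
  one_mem' := ⟨1, by ext <;> simp⟩
  mul_mem' := by
    rintro _ _ ⟨y, rfl⟩ ⟨z, rfl⟩
    refine ⟨y * z, SemidirectProduct.ext ?_ (Subtype.ext ?_)⟩
    · rw [SemidirectProduct.mul_left, inducedAction_cent h i hi hx _ y.2]
      simp [mul_comm]
    · simp
  inv_mem' := by
    rintro _ ⟨y, rfl⟩
    refine ⟨y⁻¹, SemidirectProduct.ext ?_ (Subtype.ext ?_)⟩
    · rw [SemidirectProduct.inv_left, inducedAction_cent h i hi hx _ (inv_mem y.2)]
      simp
    · simp

instance semidirectKernel_normal (h : IndexTwo x D) (i : cent x →* Multiplicative (localInt π))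
    (hi : Function.Injective i) (hx : i ⟨x, self_mem_cent x⟩ = Multiplicative.ofAdd 1) :
    (semidirectKernel h i hi hx).Normal where
  conj_mem := by
    rintro _ ⟨y, rfl⟩ ⟨z, d⟩
    refine ⟨conjHom h d y, SemidirectProduct.ext ?_ (Subtype.ext ?_)⟩
    · have e : ((d * ⟨y, h.cent_le y.2⟩ * d⁻¹ : D) : G) ∈ cent x := h.conj_mem d y
      have e' := inducedAction_cent h i hi hx _ e z⁻¹
      rw [SemidirectProduct.mul_left, SemidirectProduct.mul_left, SemidirectProduct.mul_right,
        SemidirectProduct.inv_left, ← MulAut.mul_apply, ← map_mul, e', inducedAction_apply,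
        map_inv, mul_comm z, mul_inv_cancel_right]
    · simp [conjHom]

/-- The semidirect product `P` of `D` and `ℤ_π` over `C_G(x)`. -/
abbrev SemidirectProd (h : IndexTwo x D) (i : cent x →* Multiplicative (localInt π))
    (hi : Function.Injective i) (hx : i ⟨x, self_mem_cent x⟩ = Multiplicative.ofAdd 1) : Type u :=
  (Multiplicative (localInt π) ⋊[inducedAction h i hi hx] D) ⧸ semidirectKernel h i hi hx

/-- The natural embedding of `D` into the semidirect product over `C_G(x)`. -/
def semidirectEmb (h : IndexTwo x D) (i : cent x →* Multiplicative (localInt π))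
    (hi : Function.Injective i) (hx : i ⟨x, self_mem_cent x⟩ = Multiplicative.ofAdd 1) :
    D →* SemidirectProd h i hi hx :=
  (QuotientGroup.mk' (semidirectKernel h i hi hx)).comp SemidirectProduct.inr

/-- `K = G *_D P`, where `|D : C_G(x)| = 2` and `P` is the semidirect product. -/
abbrev SemidirectK (h : IndexTwo x D) (i : cent x →* Multiplicative (localInt π))
    (hi : Function.Injective i) (hx : i ⟨x, self_mem_cent x⟩ = Multiplicative.ofAdd 1) : Type u :=
  Amalgam D.subtype (semidirectEmb h i hi hx)

end SemidirectProd

end PiLocal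

namespace PiLocal

/-! The group `K` acts on its Bass–Serre tree, and in both cases only the identity fixes a path of
three edges. Write `C` for the centralizer of `x`. A path of three edges can be moved so that its
middle edge has stabilizer `D`; a fixing element then lies in `D`, stays in `D` after conjugation by
some element of `P` outside `D`, and also after conjugation by some element of `G` outside `D`. If
`D = C`, the last property already forces it to be trivial. If `|D : C| = 2`, the elements of `D`
outside `C` are involutions inverting `C`, the property in `P` forces the element into `C`, and the
property in `G` then forces it to be `1`.

An element without fixed vertex translates an axis, and the stabilizer of that line acts faithfully
on it. The centralizer consists of translations, and `D_K` is the whole line stabilizer, which is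
infinite cyclic or infinite dihedral. So the centralizer condition holds whether or not roots exist
(`centCond_of_axis`). Uniqueness of roots in `K` reduces to vertex stabilizers, that is, to `G` and
`P` (`isUGroup_of_stabilizer`).

Up to conjugation there remain elements of `G` and of `P`. For an element of `G` not conjugate into
`P`, the centralizer and `D_K` stay inside `G`, and the condition is inherited
(`centCond_map_of_not_conj`). If `|D : C| = 2`, then `P` is a generalized dihedral group in which
all `π'`-roots exist, so nothing is left to check. If `D = C`, an element of `P` without roots is
central in `P` (`central_of_lacksRoot`); as `P` is malnormal in `K` and torsion-free, its
centralizer and its `D_K` are both equal to `P`. -/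

/-- The condition that the definition of `𝒫_π` imposes on the elements without roots. -/
def CentCond (π : Set Nat.Primes) {G : Type u} [Group G] (x : G) : Prop :=
  (∀ c ∈ cent x, IsOfFinOrder c → c = 1) ∧
    (dSet x = (cent x : Set G) ∨
      ((∃ D : Subgroup G, IndexTwo x D) ∧
        ∃ i : cent x →* Multiplicative (localInt π), Function.Injective i))

theorem mem_cent_iff {G : Type u} [Group G] {x g : G} : g ∈ cent x ↔ g * x = x * g :=
  Subgroup.mem_centralizer_singleton_iff

theorem mem_dSet_iff {G : Type u} [Group G] {x g : G} :
    g ∈ dSet x ↔ ∃ c ∈ cent x, c ≠ 1 ∧ g * c * g⁻¹ ∈ cent x := by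
  rw [dSet, Set.mem_ofPred_eq, Subgroup.ne_bot_iff_exists_ne_one]
  constructor
  · rintro ⟨⟨c, hc, d, hd, e⟩, h1⟩
    refine ⟨c, hc, fun h => h1 (Subtype.ext h), ?_⟩
    have : g * c * g⁻¹ = d := by
      rw [← e]; simp [mul_assoc]
    rwa [this]
  · rintro ⟨c, hc, h1, h⟩
    exact ⟨⟨c, hc, g * c * g⁻¹, h, by simp [mul_assoc]⟩, fun h => h1 (congrArg Subtype.val h)⟩

/-! ### Actions on trees: fixed points, lines and axes. -/

section Tree

theorem dist_le_of_mem_support {V : Type*} {T : SimpleGraph V} {v w r : V} (p : T.Walk v w)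
    (hr : r ∈ p.support) : T.dist v r ≤ p.length := by
  classical
  exact (SimpleGraph.dist_le (p.takeUntil r hr)).trans (p.length_takeUntil_le_length hr)

variable {K V : Type*} [Group K] [MulAction K V] {T : SimpleGraph V} {col : V → Bool}

/-- An action of `K` on a tree `T` that preserves a colouring `col`, such that only the identity
fixes a path with three edges. -/
structure TreeAction (K : Type*) {V : Type*} [Group K] [MulAction K V] (T : SimpleGraph V)
    (col : V → Bool) : Prop where
  connected : T.Connected
  ne_of_nonbacktracking : ∀ (n : ℕ) (p : ℕ → V), 1 ≤ n → (∀ i < n, T.Adj (p i) (p (i + 1))) →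
    (∀ i, i + 2 ≤ n → p i ≠ p (i + 2)) → p 0 ≠ p n
  adj_smul : ∀ (g : K) (v w : V), T.Adj v w → T.Adj (g • v) (g • w)
  col_smul : ∀ (g : K) (v : V), col (g • v) = col v
  col_adj : ∀ v w : V, T.Adj v w → col v ≠ col w
  acylindrical : ∀ (g : K) (a b c d : V), T.Adj a b → T.Adj b c → T.Adj c d → a ≠ c → b ≠ d →
    g • a = a → g • b = b → g • c = c → g • d = d → g = 1

/-- A bi-infinite path without backtracking. -/
structure IsLine (T : SimpleGraph V) (γ : ℤ → V) : Prop where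
  adj : ∀ n, T.Adj (γ n) (γ (n + 1))
  ne : ∀ n, γ n ≠ γ (n + 2)

/-- The element `h` translates the line `γ` by `l ≠ 0`. -/
structure IsAxis (T : SimpleGraph V) (h : K) (γ : ℤ → V) (l : ℤ) : Prop where
  line : IsLine T γ
  ne_zero : l ≠ 0
  smul_eq : ∀ n, h • γ n = γ (n + l)

namespace TreeAction

theorem isAcyclic (hT : TreeAction K T col) : T.IsAcyclic := by
  intro v c hc
  have h3 := hc.three_le_length
  refine hT.ne_of_nonbacktracking c.length c.getVert (by omega)
    (fun i hi => c.adj_getVert_succ hi) (fun i hi => ?_) (by simp)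
  exact hc.getVert_sub_one_ne_getVert_add_one (i := i + 1) (by omega)

theorem path_eq (hT : TreeAction K T col)
    {v w : V} {p q : T.Walk v w} (hp : p.IsPath) (hq : q.IsPath) : p = q :=
  congrArg Subtype.val ((hT.isAcyclic.subsingleton_path v w).elim ⟨p, hp⟩ ⟨q, hq⟩)

/-- The automorphism of the tree given by an element of the group. -/
def toHom (hT : TreeAction K T col)
    (g : K) : T →g T := ⟨fun v => g • v, fun {v w} h => hT.adj_smul g v w h⟩

theorem smul_getVert (hT : TreeAction K T col)
    {g : K} {v w : V} {p : T.Walk v w} (hp : p.IsPath) (hv : g • v = v)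
    (hw : g • w = w) (i : ℕ) : g • p.getVert i = p.getVert i := by
  have hv' : hT.toHom g v = v := hv
  have hw' : hT.toHom g w = w := hw
  have hq : ((p.map (hT.toHom g)).copy hv' hw').IsPath := by
    rw [SimpleGraph.Walk.isPath_copy]
    exact hp.map (MulAction.injective g)
  have h := congrArg (fun r : T.Walk v w => r.getVert i) (hT.path_eq hq hp)
  simp only [SimpleGraph.Walk.getVert_copy, SimpleGraph.Walk.getVert_map] at h
  exact h

theorem exists_fixed_neighbor (hT : TreeAction K T col)
    {g : K} {v w : V} (hvw : v ≠ w) (hv : g • v = v) (hw : g • w = w) :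
    ∃ s, T.Adj v s ∧ g • s = s := by
  obtain ⟨p, hp⟩ := (hT.connected v w).exists_isPath
  have h0 : 0 < p.length := by
    rw [Nat.pos_iff_ne_zero]
    exact fun h => hvw (SimpleGraph.Walk.eq_of_length_eq_zero h)
  refine ⟨p.getVert 1, ?_, hT.smul_getVert hp hv hw 1⟩
  simpa using p.adj_getVert_succ h0

theorem exists_fixed_path (hT : TreeAction K T col)
    {g : K} {v w : V} (hvw : v ≠ w) (hc : col v = col w) (hv : g • v = v)
    (hw : g • w = w) :
    ∃ s t, T.Adj v s ∧ T.Adj s t ∧ v ≠ t ∧ g • s = s ∧ g • t = t := by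
  obtain ⟨p, hp⟩ := (hT.connected v w).exists_isPath
  have h0 : p.length ≠ 0 := fun h => hvw (SimpleGraph.Walk.eq_of_length_eq_zero h)
  have h1 : p.length ≠ 1 := fun h =>
    hT.col_adj _ _ (SimpleGraph.Walk.adj_of_length_eq_one h) hc
  refine ⟨p.getVert 1, p.getVert 2, ?_, p.adj_getVert_succ (by omega), ?_,
    hT.smul_getVert hp hv hw 1, hT.smul_getVert hp hv hw 2⟩
  · simpa using p.adj_getVert_succ (i := 0) (by omega)
  · intro h
    have := hp.getVert_injOn (x₁ := 0) (x₂ := 2) (by simp) (by simp; omega) (by simpa using h)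
    omega

/-- A nontrivial element that fixes two neighbours of `c` fixes no other vertex of the
colour of `c`. -/
theorem eq_center (hT : TreeAction K T col)
    {w : K} (hw : w ≠ 1) {c p q r : V} (hp : T.Adj c p) (hq : T.Adj c q)
    (hpq : p ≠ q) (hwc : w • c = c) (hwp : w • p = p) (hwq : w • q = q) (hr : w • r = r)
    (hcol : col c = col r) : c = r := by
  by_contra hcr
  obtain ⟨s, t, hs, ht, hct, hws, hwt⟩ := hT.exists_fixed_path hcr hcol hwc hr
  -- At least one of `p`, `q` differs from `s`; prepending it to `c, s, t` gives a path of three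
  -- edges fixed by `w`.
  by_cases h : p = s
  · exact hw (hT.acylindrical w q c s t hq.symm hs ht (fun e => hpq (h.trans e.symm)) hct hwq hwc
      hws hwt)
  · exact hw (hT.acylindrical w p c s t hp.symm hs ht h hct hwp hwc hws hwt)

theorem smul_center (hT : TreeAction K T col)
    {w g : K} (hw : w ≠ 1) (hg : g * w = w * g) {c p q : V} (hp : T.Adj c p)
    (hq : T.Adj c q) (hpq : p ≠ q) (hwc : w • c = c) (hwp : w • p = p) (hwq : w • q = q) :
    g • c = c := by
  refine (hT.eq_center hw hp hq hpq hwc hwp hwq ?_ (hT.col_smul g c).symm).symm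
  rw [← mul_smul, ← hg, mul_smul, hwc]

/-- The centre is found among the fixed vertices of `w`: if `w` fixes a second vertex of the colour
of `v`, the middle of a fixed path of two edges starting at `v`; otherwise `v`, being the only fixed
vertex of its colour. -/
theorem exists_center (hT : TreeAction K T col) {w : K} (hw : w ≠ 1) {v : V} (hv : w • v = v) :
    ∃ c : V, ∀ g : K, g * w = w * g → g • c = c := by
  by_cases h : ∃ r, w • r = r ∧ r ≠ v ∧ col v = col r
  · obtain ⟨r, hr, hrv, hc⟩ := h
    obtain ⟨s, t, hs, ht, hvt, hws, hwt⟩ := hT.exists_fixed_path hrv.symm hc hv hr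
    exact ⟨s, fun g hg => hT.smul_center hw hg hs.symm ht hvt hws hv hwt⟩
  · refine ⟨v, fun g hg => ?_⟩
    by_contra hgv
    refine h ⟨g • v, ?_, hgv, (hT.col_smul g v).symm⟩
    rw [← mul_smul, ← hg, mul_smul, hv]

theorem line_injective (hT : TreeAction K T col)
    {γ : ℤ → V} (hγ : IsLine T γ) : Function.Injective γ := by
  have key : ∀ (a : ℤ) (n : ℕ), 1 ≤ n → γ a ≠ γ (a + n) := by
    intro a n hn
    have := hT.ne_of_nonbacktracking n (fun i => γ (a + i)) hn
      (fun i _ => by simpa [add_assoc] using hγ.adj (a + i))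
      (fun i _ => by simpa [add_assoc] using hγ.ne (a + i))
    simpa using this
  intro a b hab
  rcases lt_trichotomy a b with h | h | h
  · exact absurd (by rw [hab]; congr 1; omega) (key a (b - a).toNat (by omega))
  · exact h
  · exact absurd (by rw [← hab]; congr 1; omega) (key b (a - b).toNat (by omega))

theorem exists_path_line (hT : TreeAction K T col)
    {γ : ℤ → V} (hγ : IsLine T γ) (a : ℤ) (n : ℕ) : ∀ b : ℤ, b = a + n →
    ∃ w : T.Walk (γ a) (γ b), w.length = n ∧ w.IsPath ∧
      ∀ v, v ∈ w.support ↔ ∃ m : ℤ, a ≤ m ∧ m ≤ b ∧ γ m = v := by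
  induction n with
  | zero =>
    rintro b hb
    obtain rfl : b = a := by simpa using hb
    refine ⟨.nil, rfl, .nil, fun v => ?_⟩
    simp only [SimpleGraph.Walk.support_nil, List.mem_singleton]
    constructor
    · rintro rfl; exact ⟨b, le_rfl, le_rfl, rfl⟩
    · rintro ⟨m, h1, h2, rfl⟩; rw [le_antisymm h2 h1]
  | succ n ih =>
    rintro b hb
    obtain ⟨w, hl, hp, hs⟩ := ih (b - 1) (by push_cast at hb; omega)
    have hadj : T.Adj (γ (b - 1)) (γ b) := by simpa using hγ.adj (b - 1)
    refine ⟨w.concat hadj, by simp [hl], hp.concat ?_ hadj, fun v => ?_⟩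
    · rw [hs]
      rintro ⟨m, -, h2, h3⟩
      have := hT.line_injective hγ h3
      omega
    · rw [SimpleGraph.Walk.support_concat, List.mem_append, hs, List.mem_singleton]
      constructor
      · rintro (⟨m, h1, h2, rfl⟩ | rfl)
        · exact ⟨m, h1, by omega, rfl⟩
        · exact ⟨b, by push_cast at hb; omega, le_rfl, rfl⟩
      · rintro ⟨m, h1, h2, rfl⟩
        by_cases h : m = b
        · exact Or.inr (h ▸ rfl)
        · exact Or.inl ⟨m, h1, by omega, rfl⟩

theorem dist_line (hT : TreeAction K T col)
    {γ : ℤ → V} (hγ : IsLine T γ) (a b : ℤ) : T.dist (γ a) (γ b) = (b - a).natAbs := by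
  wlog hab : a ≤ b generalizing a b
  · rw [SimpleGraph.dist_comm, this b a (by omega)]; omega
  obtain ⟨w, hl, hp, -⟩ := hT.exists_path_line hγ a (b - a).toNat b (by omega)
  obtain ⟨q, hq, hql⟩ := (hT.connected (γ a) (γ b)).exists_path_of_dist
  rw [← hql, ← hT.path_eq hp hq, hl]
  omega

theorem exists_walk_in_line (hT : TreeAction K T col) {γ : ℤ → V} (hγ : IsLine T γ) (a b : ℤ) :
    ∃ w : T.Walk (γ a) (γ b), ∀ v ∈ w.support, ∃ m, γ m = v := by
  rcases le_total a b with h | h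
  · obtain ⟨w, -, -, hs⟩ := hT.exists_path_line hγ a (b - a).toNat b (by omega)
    exact ⟨w, fun v hv => ((hs v).1 hv).imp fun m h => h.2.2⟩
  · obtain ⟨w, -, -, hs⟩ := hT.exists_path_line hγ b (a - b).toNat a (by omega)
    refine ⟨w.reverse, fun v hv => ((hs v).1 ?_).imp fun m h => h.2.2⟩
    simpa using hv

/-- A line that stays at bounded distance from `γ` in both directions is contained in `γ`. -/
theorem line_subset (hT : TreeAction K T col)
    {γ δ : ℤ → V} (hγ : IsLine T γ) (hδ : IsLine T δ) {a b : ℤ} (ha : a ≠ 0)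
    {B : ℕ} (hB : ∀ k : ℤ, T.dist (δ (k * a)) (γ (k * b)) ≤ B) (n : ℤ) : ∃ m, γ m = δ n := by
  classical
  -- The factor `a.sign` makes `s = k * a` positive, and its size keeps `δ n` at distance more than
  -- `B` from both `δ (-s)` and `δ s`.
  set k : ℤ := (|n| + B + 1) * a.sign with hk
  set s : ℤ := k * a with hs
  have hs1 : |n| + B + 1 ≤ s := by
    have e : s = (|n| + B + 1) * |a| := by rw [hs, hk, mul_assoc, Int.sign_mul_self_eq_abs]
    have h1 : 1 ≤ |a| := Int.one_le_abs ha
    rw [e]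
    nlinarith [abs_nonneg n]
  have hn := abs_le.1 (le_refl |n|)
  obtain ⟨p, -, hp, hps⟩ := hT.exists_path_line hδ (-s) (s + s).toNat s (by omega)
  obtain ⟨q₁, hq₁⟩ := hT.connected.exists_walk_length_eq_dist (δ (-s)) (γ (-k * b))
  obtain ⟨q₂, hq₂⟩ := hT.connected.exists_walk_length_eq_dist (δ s) (γ (k * b))
  obtain ⟨r, hr⟩ := hT.exists_walk_in_line hγ (-k * b) (k * b)
  have h1 := hB (-k)
  have h2 := hB k
  rw [neg_mul k a, ← hs] at h1
  rw [← hs] at h2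
  have hmem : δ n ∈ p.support := (hps _).2 ⟨n, by omega, by omega, rfl⟩
  -- A detour from `δ (-s)` to `δ s` along `γ`. The path between two vertices is unique, so `δ n`
  -- lies on the detour, and the two connecting pieces are too short to reach it.
  set W := (q₁.append r).append q₂.reverse
  have hW : p = W.bypass := hT.path_eq hp W.bypass_isPath
  rw [hW] at hmem
  have hmem' := W.support_bypass_subset_support hmem
  simp only [W, SimpleGraph.Walk.mem_support_append_iff, SimpleGraph.Walk.support_reverse,
    List.mem_reverse] at hmem'
  rcases hmem' with (h | h) | h
  · have := dist_le_of_mem_support q₁ h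
    rw [hT.dist_line hδ] at this
    omega
  · exact hr _ h
  · have := dist_le_of_mem_support q₂ h
    rw [hT.dist_line hδ] at this
    omega

/-- Distances force consecutive indices to differ by `±1`, and the absence of backtracking forbids a
change of sign. -/
theorem line_reparam (hT : TreeAction K T col) {γ δ : ℤ → V} (hγ : IsLine T γ) (hδ : IsLine T δ)
    (hsub : ∀ n, ∃ m, γ m = δ n) :
    ∃ ε c : ℤ, (ε = 1 ∨ ε = -1) ∧ ∀ n, δ n = γ (ε * n + c) := by
  choose f hf using hsub
  have h1 : ∀ n, f (n + 1) - f n = 1 ∨ f (n + 1) - f n = -1 := by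
    intro n
    have h := hT.dist_line hγ (f n) (f (n + 1))
    rw [hf, hf, hT.dist_line hδ] at h
    omega
  have h2 : ∀ n, f n ≠ f (n + 2) := by
    intro n h
    apply hδ.ne n
    rw [← hf, ← hf, h]
  have h3 : ∀ n, f (n + 1 + 1) - f (n + 1) = f (n + 1) - f n := by
    intro n
    have e1 := h1 n
    have e2 := h1 (n + 1)
    have e3 := h2 n
    rw [show n + 1 + 1 = n + 2 by ring] at *
    omega
  have h4 : ∀ n, f (n + 1) - f n = f 1 - f 0 := by
    intro n
    induction n using Int.induction_on with
    | zero => rfl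
    | succ n ih => rw [h3, ih]
    | pred n ih =>
      have := h3 (-(n : ℤ) - 1)
      rw [sub_add_cancel] at this ⊢
      rw [← this, ih]
  have h5 : ∀ n, f n = (f 1 - f 0) * n + f 0 := by
    intro n
    induction n using Int.induction_on with
    | zero => simp
    | succ n ih => have := h4 n; linarith
    | pred n ih =>
      have := h4 (-(n : ℤ) - 1)
      rw [sub_add_cancel] at this
      linarith
  refine ⟨f 1 - f 0, f 0, h1 0, fun n => ?_⟩
  rw [← hf, ← h5]

theorem axis_zpow {h : K} {γ : ℤ → V} {l : ℤ} (hs : ∀ n, h • γ n = γ (n + l)) (k n : ℤ) :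
    (h ^ k) • γ n = γ (n + k * l) := by
  induction k using Int.induction_on generalizing n with
  | zero => simp
  | succ k ih => rw [zpow_add_one, mul_smul, hs, ih]; congr 1; ring
  | pred k ih =>
    have e : h⁻¹ • γ n = γ (n - l) := by rw [inv_smul_eq_iff, hs, sub_add_cancel]
    rw [zpow_sub_one, mul_smul, e, ih]
    congr 1; ring

theorem smul_line (hT : TreeAction K T col)
    {γ : ℤ → V} (hγ : IsLine T γ) (g : K) : IsLine T (fun n => g • γ n) where
  adj n := hT.adj_smul g _ _ (hγ.adj n)
  ne n h := hγ.ne n (MulAction.injective g h)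

theorem dist_smul (hT : TreeAction K T col)
    (g : K) (v w : V) : T.dist (g • v) (g • w) ≤ T.dist v w := by
  obtain ⟨p, hp⟩ := hT.connected.exists_walk_length_eq_dist v w
  rw [← hp, ← p.length_map (hT.toHom g)]
  exact SimpleGraph.dist_le _

/-- The powers of `h ^ b` translate both `γ` and its image under `g`, so the two lines stay at
bounded distance in both directions and therefore coincide. -/
theorem axis_reparam (hT : TreeAction K T col)
    {g h : K} {γ : ℤ → V} {l : ℤ} (ax : IsAxis T h γ l) {a b : ℤ} (ha : a ≠ 0)
    (e : g * h ^ a * g⁻¹ = h ^ b) :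
    ∃ ε c : ℤ, (ε = 1 ∨ ε = -1) ∧ ∀ n, g • γ n = γ (ε * n + c) := by
  refine hT.line_reparam ax.line (hT.smul_line ax.line g)
    (hT.line_subset ax.line (hT.smul_line ax.line g) (mul_ne_zero ha ax.ne_zero) (b := b * l)
      (B := T.dist (g • γ 0) (γ 0)) fun k => ?_)
  have e1 : g • γ (k * (a * l)) = (h ^ b) ^ k • g • γ 0 := by
    rw [← e, conj_zpow, ← zpow_mul, ← mul_smul, inv_mul_cancel_right, mul_smul,
      axis_zpow ax.smul_eq]
    congr 2; ring
  have e2 : γ (k * (b * l)) = (h ^ b) ^ k • γ 0 := by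
    rw [← zpow_mul, axis_zpow ax.smul_eq]
    congr 1; ring
  simp only [e1, e2]
  exact hT.dist_smul _ _ _

theorem eq_of_smul_line (hT : TreeAction K T col)
    {γ : ℤ → V} (hγ : IsLine T γ) {g h : K} (e : ∀ n, g • γ n = h • γ n) :
    g = h := by
  have key : ∀ n, (h⁻¹ * g) • γ n = γ n := fun n => by rw [mul_smul, e, inv_smul_smul]
  have := hT.acylindrical (h⁻¹ * g) (γ 0) (γ 1) (γ 2) (γ 3) (hγ.adj 0) (hγ.adj 1) (hγ.adj 2)
    (hγ.ne 0) (hγ.ne 1) (key 0) (key 1) (key 2) (key 3)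
  exact (inv_mul_eq_one.1 this).symm

/-- The axis is the union of the translates of a geodesic from `v` to `h • v`, where `v` has minimal
displacement. Minimality excludes backtracking where two translates meet. -/
theorem exists_axis (hT : TreeAction K T col)
    {h : K} (hh : ∀ v : V, h • v ≠ v) : ∃ γ l, IsAxis T h γ l := by
  have := hT.connected.nonempty
  let v := Function.argmin (fun w : V => T.dist w (h • w))
  have hv : ∀ w : V, T.dist v (h • v) ≤ T.dist w (h • w) := fun w =>
    Function.argmin_le (fun w : V => T.dist w (h • w)) w
  obtain ⟨p, hp, hl⟩ := (hT.connected v (h • v)).exists_path_of_dist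
  have h0 : p.length ≠ 0 := fun e => hh v (SimpleGraph.Walk.eq_of_length_eq_zero e).symm
  -- There are no inversions, because `h` preserves colours.
  have h1 : p.length ≠ 1 := fun e =>
    hT.col_adj _ _ (SimpleGraph.Walk.adj_of_length_eq_one e) (hT.col_smul h v).symm
  set L := p.length with hL
  let γ : ℤ → V := fun n => h ^ (n / (L : ℤ)) • p.getVert (n % (L : ℤ)).toNat
  have hLpos : (0 : ℤ) < L := by omega
  have hγ : ∀ (k : ℤ) (j : ℕ), j ≤ L → γ (k * L + j) = h ^ k • p.getVert j := by
    intro k j hj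
    rcases hj.lt_or_eq with hj | rfl
    · have e1 : (k * L + j) / (L : ℤ) = k := by
        rw [add_comm, Int.add_mul_ediv_right _ _ hLpos.ne', Int.ediv_eq_zero_of_lt (by omega)
          (by omega), zero_add]
      have e2 : (k * L + j) % (L : ℤ) = j := by
        rw [add_comm, Int.add_mul_emod_self_right, Int.emod_eq_of_lt (by omega) (by omega)]
      simp only [γ, e1, e2, Int.toNat_natCast]
    · have e1 : (k * L + L) / (L : ℤ) = k + 1 := by
        rw [show k * (L : ℤ) + L = (k + 1) * L by ring, Int.mul_ediv_cancel _ hLpos.ne']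
      have e2 : (k * L + L) % (L : ℤ) = 0 := by
        rw [show k * (L : ℤ) + L = (k + 1) * L by ring, Int.mul_emod_left]
      have e3 : p.getVert L = h • v := p.getVert_length
      simp only [γ, e1, e2, Int.toNat_zero, p.getVert_zero, zpow_add_one, mul_smul, e3]
  have hdiv : ∀ n : ℤ, ∃ (k : ℤ) (j : ℕ), j < L ∧ n = k * L + j := by
    intro n
    have e1 := Int.emod_nonneg n hLpos.ne'
    have e2 := Int.emod_lt_of_pos n hLpos
    have e3 := Int.mul_ediv_add_emod n L
    exact ⟨n / L, (n % L).toNat, by omega, by rw [Int.toNat_of_nonneg e1, mul_comm, e3]⟩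
  refine ⟨γ, L, ⟨fun n => ?_, fun n => ?_⟩, hLpos.ne', fun n => ?_⟩
  · obtain ⟨k, j, hj, rfl⟩ := hdiv n
    have e := hγ k (j + 1) hj
    push_cast at e
    rw [add_assoc, e, hγ k j hj.le]
    exact hT.adj_smul _ _ _ (p.adj_getVert_succ hj)
  · obtain ⟨k, j, hj, rfl⟩ := hdiv n
    rw [hγ k j hj.le]
    by_cases hj2 : j + 2 ≤ L
    · have e := hγ k (j + 2) hj2
      push_cast at e
      rw [add_assoc, e]
      intro h'
      have := hp.getVert_injOn (x₁ := j) (x₂ := j + 2) (by simp; omega) (by simp; omega)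
        (MulAction.injective _ h')
      omega
    -- Here `j = L - 1`. Backtracking at the junction would give the vertex `p.getVert 1` a
    -- displacement of at most `L - 2`.
    · have e := hγ (k + 1) 1 (by omega)
      rw [show k * (L : ℤ) + j + 2 = (k + 1) * L + (1 : ℕ) by push_cast; rw [add_mul]; omega, e,
        zpow_add_one, mul_smul]
      intro h'
      have e1 := MulAction.injective _ h'
      have e2 := hv (p.getVert 1)
      rw [← e1] at e2
      have e3 : p.getVert j = (p.drop 1).getVert (j - 1) := by
        rw [SimpleGraph.Walk.drop_getVert]; congr 1; omega
      have e4 := SimpleGraph.dist_le ((p.drop 1).take (j - 1))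
      rw [SimpleGraph.Walk.take_length] at e4
      rw [e3] at e2
      omega
  · obtain ⟨k, j, hj, rfl⟩ := hdiv n
    rw [hγ k j hj.le, show k * (L : ℤ) + j + L = (k + 1) * L + j by ring, hγ _ j hj.le, ← mul_smul,
      ← zpow_one_add, add_comm]

end TreeAction
end Tree
-- Centralizers and unique roots, read off from axes.
namespace TreeAction

/-- The stabilizer of a line. -/
def lineStabilizer (K : Type u) {V : Type*} [Group K] [MulAction K V] (γ : ℤ → V) : Subgroup K where
  carrier := {g | ∃ ε c : ℤ, (ε = 1 ∨ ε = -1) ∧ ∀ n, g • γ n = γ (ε * n + c)}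
  one_mem' := ⟨1, 0, Or.inl rfl, by simp⟩
  mul_mem' := by
    rintro g h ⟨ε, c, hε, hg⟩ ⟨η, d, hη, hh⟩
    refine ⟨ε * η, ε * d + c, ?_, fun n => ?_⟩
    · rcases hε with rfl | rfl <;> rcases hη with rfl | rfl <;> simp
    · rw [mul_smul, hh, hg]; congr 1; ring
  inv_mem' := by
    rintro g ⟨ε, c, hε, hg⟩
    refine ⟨ε, -ε * c, hε, fun n => ?_⟩
    rw [inv_smul_eq_iff, hg]
    congr 1
    rcases hε with rfl | rfl <;> ring

variable {K : Type u} {V : Type*} [Group K] [MulAction K V] {T : SimpleGraph V} {col : V → Bool}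

theorem translation_of_commute (hT : TreeAction K T col)
    {g h : K} {γ : ℤ → V} {l : ℤ} (ax : IsAxis T h γ l) {a : ℤ}
    (ha : a ≠ 0) (hg : g * h ^ a = h ^ a * g) : ∃ c : ℤ, ∀ n, g • γ n = γ (n + c) := by
  obtain ⟨ε, c, -, hc⟩ := hT.axis_reparam ax ha (g := g) (b := a) (by rw [hg, mul_inv_cancel_right])
  have h1 : (g * h ^ a) • γ 0 = (h ^ a * g) • γ 0 := by rw [hg]
  rw [mul_smul, mul_smul, axis_zpow ax.smul_eq, hc, hc, axis_zpow ax.smul_eq] at h1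
  have h2 := hT.line_injective ax.line h1
  have h3 : (ε - 1) * (a * l) = 0 := by linarith
  have h4 : ε = 1 := by
    rcases mul_eq_zero.1 h3 with h | h
    · linarith
    · exact absurd h (mul_ne_zero ha ax.ne_zero)
  refine ⟨c, fun n => ?_⟩
  rw [hc, h4, one_mul]

theorem translation_of_mem_cent (hT : TreeAction K T col)
    {g h : K} {γ : ℤ → V} {l : ℤ} (ax : IsAxis T h γ l)
    (hg : g ∈ cent h) : ∃ c : ℤ, ∀ n, g • γ n = γ (n + c) :=
  hT.translation_of_commute ax one_ne_zero (by simpa using mem_cent_iff.1 hg)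

theorem eq_of_translation (hT : TreeAction K T col)
    {γ : ℤ → V} (hγ : IsLine T γ) {g h : K} {a b : ℤ} (hab : a = b)
    (hg : ∀ n, g • γ n = γ (n + a)) (hh : ∀ n, h • γ n = γ (n + b)) : g = h :=
  hT.eq_of_smul_line hγ fun n => by rw [hg, hh, hab]

theorem eq_one_of_translation_zero (hT : TreeAction K T col)
    {γ : ℤ → V} (hγ : IsLine T γ) {g : K} {a : ℤ} (ha : a = 0)
    (hg : ∀ n, g • γ n = γ (n + a)) : g = 1 :=
  hT.eq_of_translation hγ ha hg (by simp)

theorem mem_cent_iff_of_axis (hT : TreeAction K T col)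
    {g h : K} {γ : ℤ → V} {l : ℤ} (ax : IsAxis T h γ l) {ε c : ℤ}
    (hg : ∀ n, g • γ n = γ (ε * n + c)) : g ∈ cent h ↔ ε = 1 := by
  rw [mem_cent_iff]
  constructor
  · intro e
    have h1 : (g * h) • γ 0 = (h * g) • γ 0 := by rw [e]
    rw [mul_smul, mul_smul, ax.smul_eq, hg, hg, ax.smul_eq] at h1
    have h2 := hT.line_injective ax.line h1
    have h3 : (ε - 1) * l = 0 := by linarith
    rcases mul_eq_zero.1 h3 with h | h
    · linarith
    · exact absurd h ax.ne_zero
  · rintro rfl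
    refine hT.eq_of_smul_line ax.line fun n => ?_
    rw [mul_smul, mul_smul, ax.smul_eq, hg, hg, ax.smul_eq]
    congr 1; ring

theorem ne_one_of_axis (hT : TreeAction K T col)
    {h : K} {γ : ℤ → V} {l : ℤ} (ax : IsAxis T h γ l) : h ≠ 1 := by
  rintro rfl
  have h1 := ax.smul_eq 0
  rw [one_smul] at h1
  have := hT.line_injective ax.line h1
  exact ax.ne_zero (by linarith)

theorem dSet_of_axis (hT : TreeAction K T col) {h : K} {γ : ℤ → V} {l : ℤ} (ax : IsAxis T h γ l) :
    (lineStabilizer K γ : Set K) = dSet h := by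
  ext g
  rw [mem_dSet_iff]
  constructor
  · rintro ⟨ε, c, -, hg⟩
    refine ⟨h, self_mem_cent h, hT.ne_one_of_axis ax, ?_⟩
    have e : g * h * g⁻¹ = h ^ ε := by
      rw [mul_inv_eq_iff_eq_mul]
      refine hT.eq_of_smul_line ax.line fun n => ?_
      rw [mul_smul, mul_smul, ax.smul_eq, hg, hg, axis_zpow ax.smul_eq]
      congr 1; ring
    rw [e]
    exact zpow_mem (self_mem_cent h) ε
  · rintro ⟨c, hc, hc1, hc'⟩
    obtain ⟨s, hs⟩ := hT.translation_of_mem_cent ax hc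
    obtain ⟨s', hs'⟩ := hT.translation_of_mem_cent ax hc'
    have hs0 : s ≠ 0 := fun e => hc1 (hT.eq_one_of_translation_zero ax.line e hs)
    -- Both `(g * c * g⁻¹) ^ s` and `c ^ s'` translate by `s * s'`, so they are equal by
    -- faithfulness, and `g` preserves the axis of `c`, which is `γ`.
    refine hT.axis_reparam ⟨ax.line, hs0, hs⟩ hs0 (b := s') ?_
    rw [← conj_zpow]
    exact hT.eq_of_translation ax.line (mul_comm s s') (axis_zpow hs' s) (axis_zpow hs s')

/-- The centralizer is the group of translations inside the line stabilizer: either all of it or,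
when there is a reflection, of index two. The translation length embeds it in `ℤ`, hence in `ℤ_π`.
-/
theorem centCond_of_axis (hT : TreeAction K T col)
    (π : Set Nat.Primes) {h : K} {γ : ℤ → V} {l : ℤ} (ax : IsAxis T h γ l) :
    CentCond π h := by
  have hcent : ∀ c : cent h, ∃ s : ℤ, ∀ n, (c : K) • γ n = γ (n + s) := fun c =>
    hT.translation_of_mem_cent ax c.2
  choose s hs using hcent
  have huniq : ∀ (c : cent h) (a : ℤ), (∀ n, (c : K) • γ n = γ (n + a)) → s c = a := by
    intro c a ha
    have := (hs c 0).symm.trans (ha 0)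
    have := hT.line_injective ax.line this
    linarith
  refine ⟨fun c hc hfin => ?_, ?_⟩
  · obtain ⟨n, hn, e⟩ := isOfFinOrder_iff_pow_eq_one.1 hfin
    have h1 := axis_zpow (hs ⟨c, hc⟩) n 0
    simp only [zpow_natCast, e, one_smul] at h1
    have h2 := hT.line_injective ax.line h1
    refine hT.eq_one_of_translation_zero ax.line ?_ (hs ⟨c, hc⟩)
    have h3 : (n : ℤ) * s ⟨c, hc⟩ = 0 := by linarith
    rcases mul_eq_zero.1 h3 with h | h
    · omega
    · exact h
  have hle : cent h ≤ lineStabilizer K γ := fun c hc =>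
    ⟨1, s ⟨c, hc⟩, Or.inl rfl, fun n => by rw [one_mul]; exact hs ⟨c, hc⟩ n⟩
  by_cases hall : lineStabilizer K γ ≤ cent h
  · left
    rw [← hT.dSet_of_axis ax, le_antisymm hall hle]
  · right
    obtain ⟨t, ht, htc⟩ := SetLike.not_le_iff_exists.1 hall
    refine ⟨⟨lineStabilizer K γ, hT.dSet_of_axis ax, ?_⟩, ?_⟩
    · refine Subgroup.relIndex_eq_two_iff.2 ⟨t, ht, fun b hb => ?_⟩
      obtain ⟨η, d, hη, hd⟩ := ht
      obtain ⟨ε, c, hε, hc⟩ := hb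
      have hη1 : η = -1 := hη.resolve_left fun e => htc ((hT.mem_cent_iff_of_axis ax hd).2 e)
      have hbt : ∀ n, (b * t) • γ n = γ (ε * η * n + (ε * d + c)) := fun n => by
        rw [mul_smul, hd, hc]; congr 1; ring
      rw [hT.mem_cent_iff_of_axis ax hbt, hT.mem_cent_iff_of_axis ax hc, hη1]
      rcases hε with rfl | rfl
      · right; simp
      · left; simp
    · refine ⟨MonoidHom.mk' (fun c => Multiplicative.ofAdd ((s c : ℤ) : localInt π)) ?_, ?_⟩
      · intro c d
        rw [← ofAdd_add, ← Int.cast_add]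
        congr 2
        refine huniq _ _ fun n => ?_
        rw [Subgroup.coe_mul, mul_smul, hs, hs]
        congr 1; ring
      · intro c d hcd
        have h1 : ((s c : ℤ) : localInt π) = ((s d : ℤ) : localInt π) := hcd
        exact Subtype.ext (hT.eq_of_translation ax.line (Int.cast_injective h1) (hs c) (hs d))

theorem eq_of_pow_eq_of_axis (hT : TreeAction K T col)
    {h g : K} {γ : ℤ → V} {l : ℤ} (ax : IsAxis T h γ l) {m : ℕ}
    (hm : m ≠ 0) (e : h ^ m = g ^ m) : h = g := by
  have hm' : (m : ℤ) ≠ 0 := by exact_mod_cast hm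
  obtain ⟨c, hc⟩ := hT.translation_of_commute ax (g := g) hm' (by
    rw [zpow_natCast, e, ← pow_succ, pow_succ'])
  have h1 := axis_zpow ax.smul_eq m 0
  rw [zpow_natCast, e, ← zpow_natCast, axis_zpow hc] at h1
  have h2 := hT.line_injective ax.line h1
  refine hT.eq_of_translation ax.line ?_ ax.smul_eq hc
  exact mul_left_cancel₀ hm' (by linarith)

/-- If `g` and `h` are both elliptic and `g ^ m = h ^ m ≠ 1`, both commute with this power and so
fix its centre. If the power is trivial, each is compared with `1` in its own stabilizer. -/
theorem isUGroup_of_stabilizer (hT : TreeAction K T col) {π : Set Nat.Primes}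
    (hS : ∀ (v : V) (m : ℕ), IsPrimeTo π m → ∀ g h : K, g • v = v → h • v = v →
      g ^ m = h ^ m → g = h) : IsUGroup π K := by
  intro m hm g h e
  change g ^ m = h ^ m at e
  by_cases hg : ∃ v : V, g • v = v
  swap
  · obtain ⟨γ, l, ax⟩ := hT.exists_axis (h := g) (fun v hv => hg ⟨v, hv⟩)
    exact hT.eq_of_pow_eq_of_axis ax hm.1 e
  by_cases hh : ∃ v : V, h • v = v
  swap
  · obtain ⟨γ, l, ax⟩ := hT.exists_axis (h := h) (fun v hv => hh ⟨v, hv⟩)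
    exact (hT.eq_of_pow_eq_of_axis ax hm.1 e.symm).symm
  obtain ⟨v, hv⟩ := hg
  obtain ⟨w, hw⟩ := hh
  by_cases h1 : g ^ m = 1
  · rw [hS v m hm g 1 hv (one_smul _ _) (by rw [h1, one_pow]),
      hS w m hm h 1 hw (one_smul _ _) (by rw [← e, h1, one_pow])]
  · have hvm : g ^ m • v = v := (MulAction.stabilizer K v).pow_mem hv m
    obtain ⟨c, hc⟩ := hT.exists_center h1 hvm
    refine hS c m hm g h (hc g (by rw [← pow_succ, pow_succ'])) (hc h ?_) e
    rw [e, ← pow_succ, pow_succ']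

end TreeAction
-- The Bass–Serre tree of an amalgam and the normal form theorem.
section Amalgams

variable {K : Type u} [Group K]

/-- `ReducedProd S b k`: the element `k` is the product of a nonempty reduced word with letters
from `S false` and `S true`, the first of which belongs to `S b`. -/
inductive ReducedProd (S : Bool → Subgroup K) : Bool → K → Prop
  | single {b : Bool} {x : K} : x ∈ S b → x ∉ S (!b) → ReducedProd S b x
  | cons {b : Bool} {x k : K} : x ∈ S b → x ∉ S (!b) → ReducedProd S (!b) k →
      ReducedProd S b (x * k)

/-- The group `K` is the free product of its subgroups `S false` and `S true` with their
intersection amalgamated. -/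
structure IsAmalgam (S : Bool → Subgroup K) : Prop where
  generate : ∀ H : Subgroup K, (∀ b, S b ≤ H) → H = ⊤
  notMem : ∀ b k, ReducedProd S b k → k ∉ S (!b)

/-- The vertices of the Bass–Serre tree. -/
abbrev Vertex (S : Bool → Subgroup K) : Type u := Σ b : Bool, K ⧸ S b

/-- The vertex given by the coset of `k` modulo `S b`. -/
def vtx (S : Bool → Subgroup K) (b : Bool) (k : K) : Vertex S := ⟨b, (k : K ⧸ S b)⟩

/-- The Bass–Serre tree. -/
def bassSerre (S : Bool → Subgroup K) : SimpleGraph (Vertex S) where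
  Adj v w := ∃ b k, v = vtx S b k ∧ w = vtx S (!b) k
  symm := ⟨by
    rintro _ _ ⟨b, k, rfl, rfl⟩
    exact ⟨!b, k, rfl, by rw [Bool.not_not]⟩⟩
  loopless := ⟨by
    rintro v ⟨b, k, h1, h2⟩
    have h := congrArg Sigma.fst (h1.symm.trans h2)
    simp [vtx] at h⟩

variable {S : Bool → Subgroup K}

theorem bassSerre_adj_vtx (b : Bool) (k : K) : (bassSerre S).Adj (vtx S b k) (vtx S (!b) k) :=
  ⟨b, k, rfl, rfl⟩

theorem vtx_eq_iff {b : Bool} {k l : K} : vtx S b k = vtx S b l ↔ k⁻¹ * l ∈ S b := by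
  rw [← QuotientGroup.eq]
  simp [vtx]

theorem smul_vtx (g : K) (b : Bool) (k : K) : g • vtx S b k = vtx S b (g * k) := rfl

theorem exists_vtx (v : Vertex S) : ∃ k, v = vtx S v.1 k := by
  obtain ⟨b, q⟩ := v
  obtain ⟨k, rfl⟩ := QuotientGroup.mk_surjective q
  exact ⟨k, rfl⟩

theorem smul_vtx_eq_iff {g : K} {b : Bool} {k : K} :
    g • vtx S b k = vtx S b k ↔ k⁻¹ * g * k ∈ S b := by
  rw [smul_vtx, eq_comm, vtx_eq_iff, mul_assoc]

theorem smul_vtx_one_iff {g : K} {b : Bool} : g • vtx S b 1 = vtx S b 1 ↔ g ∈ S b := by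
  rw [smul_vtx_eq_iff]; simp

theorem vtx_adj_iff {b : Bool} {k : K} {w : Vertex S} :
    (bassSerre S).Adj (vtx S b k) w ↔ ∃ s ∈ S b, w = vtx S (!b) (k * s) := by
  constructor
  · rintro ⟨c, l, h1, rfl⟩
    obtain rfl : b = c := congrArg Sigma.fst h1
    exact ⟨k⁻¹ * l, vtx_eq_iff.1 h1, by rw [mul_inv_cancel_left]⟩
  · rintro ⟨s, hs, rfl⟩
    have : vtx S b k = vtx S b (k * s) := vtx_eq_iff.2 (by rwa [inv_mul_cancel_left])
    rw [this]
    exact bassSerre_adj_vtx b _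

namespace IsAmalgam

theorem connected (hS : IsAmalgam S) : (bassSerre S).Connected := by
  let v₀ := vtx S false 1
  have h1 : (bassSerre S).Adj v₀ (vtx S true 1) := bassSerre_adj_vtx false 1
  have smulReach : ∀ (g : K) {v w}, (bassSerre S).Reachable v w →
      (bassSerre S).Reachable (g • v) (g • w) := by
    intro g v w h
    let f : bassSerre S →g bassSerre S := ⟨fun v => g • v, by
      rintro _ _ ⟨b, k, rfl, rfl⟩
      exact ⟨b, g * k, rfl, rfl⟩⟩
    exact h.map f
  let H : Subgroup K :=
    { carrier := {k | (bassSerre S).Reachable v₀ (k • v₀)}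
      one_mem' := by
        change (bassSerre S).Reachable v₀ ((1 : K) • v₀)
        rw [one_smul]
      mul_mem' := by
        intro a b ha hb
        change (bassSerre S).Reachable v₀ ((a * b) • v₀)
        rw [mul_smul]
        exact SimpleGraph.Reachable.trans ha (smulReach a hb)
      inv_mem' := by
        intro a ha
        have := smulReach a⁻¹ ha
        rw [inv_smul_smul] at this
        exact this.symm }
  have hH : H = ⊤ := by
    refine hS.generate H fun b k hk => ?_
    change (bassSerre S).Reachable v₀ (k • v₀)
    cases b with
    | false => rw [smul_vtx_one_iff.2 hk]
    | true =>
      have h2 := smulReach k h1.reachable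
      rw [smul_vtx_one_iff.2 hk] at h2
      exact h1.reachable.trans h2.symm
  have key : ∀ v, (bassSerre S).Reachable v₀ v := by
    intro v
    obtain ⟨k, hk⟩ := exists_vtx v
    have hk' : k ∈ H := hH ▸ Subgroup.mem_top k
    have h2 : (bassSerre S).Reachable v₀ (vtx S false k) := by
      have : (bassSerre S).Reachable v₀ (k • v₀) := hk'
      rwa [smul_vtx, mul_one] at this
    rw [hk]
    cases v.1 with
    | false => exact h2
    | true => exact h2.trans (bassSerre_adj_vtx false k).reachable
  exact { preconnected := fun v w => (key v).symm.trans (key w), nonempty := ⟨v₀⟩ }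

/-- Edges are elements `e i` up to `S false ⊓ S true`. The quotient of consecutive ones lies in the
factor of the shared vertex, and outside the other factor because there is no backtracking. So the
path spells a reduced word, and closing it up would contradict `notMem`. -/
theorem ne_of_nonbacktracking (hS : IsAmalgam S) (n : ℕ) (p : ℕ → Vertex S) (hn : 1 ≤ n)
    (hadj : ∀ i < n, (bassSerre S).Adj (p i) (p (i + 1)))
    (hne : ∀ i, i + 2 ≤ n → p i ≠ p (i + 2)) : p 0 ≠ p n := by
  have hadj' : ∀ i, ∃ b e, i < n → p i = vtx S b e ∧ p (i + 1) = vtx S (!b) e := by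
    intro i
    by_cases hi : i < n
    · obtain ⟨b, e, h⟩ := hadj i hi
      exact ⟨b, e, fun _ => h⟩
    -- A dummy value beyond the end of the path.
    · exact ⟨true, 1, fun h => absurd h hi⟩
  choose b e h using hadj'
  have hb : ∀ i, i + 1 < n → b (i + 1) = !b i := fun i hi => by
    have := (h i (by omega)).2.symm.trans (h (i + 1) hi).1
    exact (congrArg Sigma.fst this).symm
  have hx : ∀ i, i + 1 < n → (e i)⁻¹ * e (i + 1) ∈ S (!b i) := fun i hi => by
    have := (h i (by omega)).2.symm.trans (h (i + 1) hi).1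
    rw [hb i hi] at this
    exact vtx_eq_iff.1 this
  have hx' : ∀ i, i + 1 < n → (e i)⁻¹ * e (i + 1) ∉ S (!!b i) := fun i hi hmem => by
    refine hne i (by omega) ?_
    rw [(h i (by omega)).1, (h (i + 1) hi).2, hb i hi]
    rw [Bool.not_not] at hmem ⊢
    exact vtx_eq_iff.2 hmem
  have hred : ∀ k i, i + k + 1 < n → ReducedProd S (!b i) ((e i)⁻¹ * e (i + k + 1)) := by
    intro k
    induction k with
    | zero => exact fun i hi => .single (hx i hi) (hx' i hi)
    | succ k ih =>
      intro i hi
      have h1 := ih (i + 1) (by omega)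
      rw [hb i (by omega)] at h1
      have h2 := ReducedProd.cons (hx i (by omega)) (hx' i (by omega)) h1
      rw [show i + (k + 1) + 1 = i + 1 + k + 1 by omega]
      rwa [mul_assoc, mul_inv_cancel_left] at h2
  intro h0
  obtain rfl | hn2 : n = 1 ∨ 2 ≤ n := by omega
  · exact (hadj 0 one_pos).ne h0
  · have h1 := (h 0 (by omega)).1
    have h2 := (h (n - 1) (by omega)).2
    rw [show n - 1 + 1 = n by omega, ← h0, h1] at h2
    have h3 : b 0 = !b (n - 1) := congrArg Sigma.fst h2
    rw [← h3] at h2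
    have h4 := hred (n - 2) 0 (by omega)
    rw [show 0 + (n - 2) + 1 = n - 1 by omega] at h4
    refine hS.notMem _ _ h4 ?_
    rw [Bool.not_not]
    exact vtx_eq_iff.1 h2

/-- The hypothesis `hM` is acylindricity for a path whose middle edge is the base edge. Translation,
and reversal when the second vertex has the wrong colour, reduce every path of three edges to this
one. -/
theorem treeAction (hS : IsAmalgam S)
    (hM : ∀ a b g : K, a ∈ S false → a ∉ S true → b ∈ S true → b ∉ S false → g ∈ S false →
      g ∈ S true → a * g * a⁻¹ ∈ S true → b⁻¹ * g * b ∈ S false → g = 1) :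
    TreeAction K (bassSerre S) Sigma.fst where
  connected := hS.connected
  ne_of_nonbacktracking := hS.ne_of_nonbacktracking
  adj_smul := by
    rintro g _ _ ⟨b, k, rfl, rfl⟩
    exact ⟨b, g * k, rfl, rfl⟩
  col_smul _ _ := rfl
  col_adj := by
    rintro _ _ ⟨b, k, rfl, rfl⟩
    simp [vtx]
  acylindrical := by
    have key : ∀ (g : K) (v₀ v₁ v₂ v₃ : Vertex S), v₁.1 = false → (bassSerre S).Adj v₀ v₁ →
        (bassSerre S).Adj v₁ v₂ → (bassSerre S).Adj v₂ v₃ → v₀ ≠ v₂ → v₁ ≠ v₃ →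
        g • v₀ = v₀ → g • v₁ = v₁ → g • v₂ = v₂ → g • v₃ = v₃ → g = 1 := by
      intro g v₀ v₁ v₂ v₃ hc h01 h12 h23 h02 h13 e0 e1 e2 e3
      obtain ⟨f, hf⟩ := exists_vtx v₁
      rw [hc] at hf
      subst hf
      obtain ⟨s, hs, rfl⟩ := vtx_adj_iff.1 h01.symm
      obtain ⟨t, ht, rfl⟩ := vtx_adj_iff.1 h12
      obtain ⟨r, hr, rfl⟩ := vtx_adj_iff.1 h23
      simp only [Bool.not_false, Bool.not_true] at *
      rw [Ne, vtx_eq_iff] at h02 h13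
      rw [smul_vtx_eq_iff] at e0 e1 e2 e3
      -- The middle edge is the coset of `f * t`; conjugating by this element moves it to the base
      -- edge.
      have h := hM (s⁻¹ * t) r (t⁻¹ * (f⁻¹ * g * f) * t) (mul_mem (inv_mem hs) ht)
        (by simpa [mul_assoc] using h02) hr
        (fun h => h13 (by simpa [mul_assoc] using mul_mem ht h))
        (mul_mem (mul_mem (inv_mem ht) e1) ht)
        (by simpa [mul_assoc] using e2)
        (by simpa [mul_assoc] using e0)
        (by simpa [mul_assoc] using e3)
      have h' : g = f * t * (t⁻¹ * (f⁻¹ * g * f) * t) * (f * t)⁻¹ := by group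
      rw [h', h]
      group
    intro g a b c d hab hbc hcd hac hbd ha hb hc hd
    by_cases hcol : b.1 = false
    · exact key g a b c d hcol hab hbc hcd hac hbd ha hb hc hd
    · refine key g d c b a ?_ hcd.symm hbc.symm hab.symm hbd.symm hac.symm hd hc hb ha
      obtain ⟨b', k, rfl, rfl⟩ := hbc
      simpa [vtx] using hcol

end IsAmalgam

section Pushout

open Monoid

variable {H : Type u} [Group H] {F : Bool → Type u} [∀ b, Group (F b)] {φ : ∀ b, H →* F b}

theorem isAmalgam_pushoutI (hφ : ∀ b, Function.Injective (φ b)) :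
    IsAmalgam (fun b => (PushoutI.of (φ := φ) b).range) where
  generate := by
    intro L hL
    refine eq_top_iff.2 fun k _ => ?_
    induction k using PushoutI.induction_on with
    | of b g => exact hL b ⟨g, rfl⟩
    | base h => exact hL true ⟨φ true h, PushoutI.of_apply_eq_base φ true h⟩
    | mul x y hx hy => exact mul_mem (hx trivial) (hy trivial)
  notMem := by
    set S : Bool → Subgroup (PushoutI φ) := fun b => (PushoutI.of (φ := φ) b).range with hSdef
    have hletter : ∀ b x, x ∈ S b → x ∉ S (!b) →
        ∃ g : F b, PushoutI.of b g = x ∧ g ∉ (φ b).range := by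
      rintro b _ ⟨g, rfl⟩ hx
      refine ⟨g, rfl, ?_⟩
      rintro ⟨h, rfl⟩
      refine hx ⟨φ (!b) h, ?_⟩
      rw [PushoutI.of_apply_eq_base, PushoutI.of_apply_eq_base]
    have hne : ∀ {b} {g : F b}, g ∉ (φ b).range → g ≠ 1 := by
      rintro b g hg rfl
      exact hg (one_mem _)
    have hword : ∀ b k, ReducedProd S b k → ∃ w : CoprodI.Word F, PushoutI.Reduced φ w ∧
        PushoutI.ofCoprodI w.prod = k ∧ w.fstIdx = some b := by
      intro b k hk
      induction hk with
      | single h1 h2 =>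
        obtain ⟨g, rfl, hg⟩ := hletter _ _ h1 h2
        refine ⟨CoprodI.Word.cons g .empty (by simp [CoprodI.Word.fstIdx]) (hne hg), ?_, ?_, ?_⟩
        · intro l hl
          simp only [CoprodI.Word.cons, CoprodI.Word.empty, List.mem_singleton] at hl
          subst hl
          exact hg
        · simp
        · simp
      | @cons b x k h1 h2 _ ih =>
        obtain ⟨g, rfl, hg⟩ := hletter _ _ h1 h2
        obtain ⟨w, hw, hwp, hwi⟩ := ih
        refine ⟨CoprodI.Word.cons g w (by rw [hwi]; simp) (hne hg), ?_, ?_, ?_⟩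
        · intro l hl
          simp only [CoprodI.Word.cons, List.mem_cons] at hl
          rcases hl with rfl | hl
          · exact hg
          · exact hw l hl
        · simp [hwp]
        · simp
    have hbase : ∀ b k, ReducedProd S b k → k ∉ (PushoutI.base φ).range := by
      intro b k hk hmem
      obtain ⟨w, hw, rfl, hwi⟩ := hword b k hk
      rw [hw.eq_empty_of_mem_range hφ hmem] at hwi
      simp [CoprodI.Word.fstIdx, CoprodI.Word.empty] at hwi
    intro b k hk hmem
    by_cases h : k ∈ S b
    · have h' : k ∈ S b ⊓ S (!b) := ⟨h, hmem⟩
      rw [hSdef] at h'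
      simp only [PushoutI.inf_of_range_eq_base_range hφ (show b ≠ !b by simp)] at h'
      exact hbase b k hk h'
    -- Prefixing the letter `k⁻¹` gives a reduced word with value `1`, which lies in the base group.
    · have h1 : ReducedProd S (!b) (k⁻¹ * k) :=
        .cons (inv_mem hmem) (by rw [Bool.not_not]; exact fun h' => h (inv_mem_iff.1 h'))
          (by rwa [Bool.not_not])
      rw [inv_mul_cancel] at h1
      exact hbase _ _ h1 (one_mem _)

end Pushout

end Amalgams

/-! ### Transfer of the conditions along monomorphisms and conjugation. -/

section Transfer

variable {π : Set Nat.Primes} {G K : Type u} [Group G] [Group K]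

theorem LacksRoot.of_map {f : G →* K} {g : G} (h : LacksRoot π (f g)) : LacksRoot π g := by
  obtain ⟨m, hm, hr⟩ := h
  exact ⟨m, hm, fun y hy => hr (f y) (by rw [← map_pow, hy])⟩

/-- The condition on `g` passes to its image under a monomorphism `f` if the centralizer and the
set `D_K (f g)` lie in the image of `f`. -/
theorem CentCond.map {f : G →* K} (hf : Function.Injective f) {g : G}
    (hc : ∀ k ∈ cent (f g), k ∈ f.range) (hd : ∀ k ∈ dSet (f g), k ∈ f.range)
    (h : CentCond π g) : CentCond π (f g) := by
  have mem : ∀ c, f c ∈ cent (f g) ↔ c ∈ cent g := by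
    intro c
    rw [mem_cent_iff, mem_cent_iff, ← map_mul, ← map_mul, hf.eq_iff]
  have hcent : cent (f g) = (cent g).map f := by
    ext k
    constructor
    · intro hk
      obtain ⟨c, rfl⟩ := hc k hk
      exact ⟨c, (mem c).1 hk, rfl⟩
    · rintro ⟨c, hc', rfl⟩
      exact (mem c).2 hc'
  have memd : ∀ c, f c ∈ dSet (f g) ↔ c ∈ dSet g := by
    intro c
    rw [mem_dSet_iff, mem_dSet_iff]
    constructor
    · rintro ⟨k, hk, hk1, hk2⟩
      obtain ⟨d, rfl⟩ := hc k hk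
      refine ⟨d, (mem d).1 hk, fun e => hk1 (by rw [e, map_one]), (mem _).1 ?_⟩
      simpa using hk2
    · rintro ⟨d, hd, hd1, hd2⟩
      refine ⟨f d, (mem d).2 hd, fun e => hd1 (hf (by rw [e, map_one])), ?_⟩
      simpa using (mem _).2 hd2
  have hdset : dSet (f g) = f '' dSet g := by
    ext k
    constructor
    · intro hk
      obtain ⟨c, rfl⟩ := hd k hk
      exact ⟨c, (memd c).1 hk, rfl⟩
    · rintro ⟨c, hc', rfl⟩
      exact (memd c).2 hc'
  refine ⟨fun k hk hfin => ?_, ?_⟩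
  · obtain ⟨c, rfl⟩ := hc k hk
    rw [h.1 c ((mem c).1 hk) (hf.isOfFinOrder_iff.1 hfin), map_one]
  · refine h.2.imp (fun e => ?_) ?_
    · rw [hdset, e, hcent, Subgroup.coe_map]
    · rintro ⟨⟨D, hD⟩, i, hi⟩
      refine ⟨⟨D.map f, ?_, ?_⟩, ?_⟩
      · rw [hdset, Subgroup.coe_map, hD.coe_eq]
      · rw [hcent, Subgroup.relIndex_map_map_of_injective _ _ hf, hD.relIndex_eq]
      · let e : cent g ≃* (cent g).map f := (cent g).equivMapOfInjective f hf
        let e' : cent (f g) ≃* (cent g).map f := MulEquiv.subgroupCongr hcent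
        exact ⟨i.comp ((e'.trans e.symm).toMonoidHom), hi.comp (e'.trans e.symm).injective⟩

theorem CentCond.conj {g : G} (k : G) (h : CentCond π g) : CentCond π (k * g * k⁻¹) := by
  have := CentCond.map (f := (MulAut.conj k).toMonoidHom) (MulAut.conj k).injective
    (fun y _ => (MulAut.conj k).surjective y) (fun y _ => (MulAut.conj k).surjective y) h
  simpa using this

theorem LacksRoot.conj {g : G} (k : G) (h : LacksRoot π g) : LacksRoot π (k * g * k⁻¹) := by
  obtain ⟨m, hm, hr⟩ := h
  refine ⟨m, hm, fun y hy => hr (k⁻¹ * y * k) ?_⟩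
  have := conj_pow (i := m) (a := k⁻¹) (b := y)
  rw [inv_inv] at this
  rw [this, hy]
  group

end Transfer

/-! ### Elements that fix a vertex of the tree. -/

section Elliptic

variable {π : Set Nat.Primes} {K : Type u} [Group K] {S : Bool → Subgroup K}

theorem inP_of_treeAction (hT : TreeAction K (bassSerre S) Sigma.fst)
    (hU : ∀ b, ∀ m, IsPrimeTo π m → ∀ g ∈ S b, ∀ h ∈ S b,
      g ^ m = h ^ m → g = h)
    (hell : ∀ b, ∀ z ∈ S b, LacksRoot π z → CentCond π z) : InP π K where
  isUGroup := by
    refine hT.isUGroup_of_stabilizer fun v m hm g h hg hh e => ?_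
    obtain ⟨k, hk⟩ := exists_vtx v
    rw [hk, smul_vtx_eq_iff] at hg hh
    have hp : ∀ y : K, (k⁻¹ * y * k) ^ m = k⁻¹ * y ^ m * k := fun y => by
      simpa using conj_pow (i := m) (a := k⁻¹) (b := y)
    have := hU _ m hm _ hg _ hh (by rw [hp, hp, e])
    exact mul_left_cancel (mul_right_cancel this)
  cond z hz := by
    change CentCond π z
    by_cases hfix : ∃ v : Vertex S, z • v = v
    · obtain ⟨v, hv⟩ := hfix
      obtain ⟨k, hk⟩ := exists_vtx v
      rw [hk, smul_vtx_eq_iff] at hv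
      have h1 : LacksRoot π (k⁻¹ * z * k) := by simpa using hz.conj k⁻¹
      have h2 := (hell _ _ hv h1).conj k
      have e : k * (k⁻¹ * z * k) * k⁻¹ = z := by group
      rwa [e] at h2
    · obtain ⟨γ, l, ax⟩ := hT.exists_axis (h := z) (fun v hv => hfix ⟨v, hv⟩)
      exact hT.centCond_of_axis π ax

/-- By `hz` the element `f g` fixes no vertex of colour `true`, hence only the base vertex of `G`;
so its centralizer lies in `G`. If `k` in `D_K (f g)` moved that vertex, some `w ≠ 1` of the
centralizer would fix an edge there. The elements of `N` fix every neighbour of the base vertex of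
`S true`, so by `hw` the end of colour `true` is a centre of `w`; then `f g`, which commutes with
`w`, fixes it, against `hz`. -/
theorem centCond_map_of_not_conj (hT : TreeAction K (bassSerre S) Sigma.fst)
    {G : Type u} [Group G] {f : G →* K} (hf : Function.Injective f)
    (hS : S false = f.range) (hne : ∃ p ∈ S true, p ∉ S false) {N : Subgroup K}
    (hN : ∀ n ∈ N, n ∈ S true ∧ ∀ p ∈ S true, p⁻¹ * n * p ∈ S false) {g : G}
    (hz : ∀ k, k⁻¹ * f g * k ∉ S true)
    (hw : ∀ w ∈ cent g, ∀ a : G, f (a⁻¹ * w * a) ∈ S true → f (a⁻¹ * w * a) ∈ N)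
    (h : CentCond π g) : CentCond π (f g) := by
  have hcent : ∀ k ∈ cent (f g), k ∈ S false := by
    intro k hk
    rw [← smul_vtx_one_iff]
    by_contra hkv
    have h1 : f g • vtx S false 1 = vtx S false 1 := smul_vtx_one_iff.2 (hS ▸ ⟨g, rfl⟩)
    have h2 : f g • k • vtx S false 1 = k • vtx S false 1 := by
      rw [← mul_smul, ← mem_cent_iff.1 hk, mul_smul, h1]
    obtain ⟨s, hs, hgs⟩ := hT.exists_fixed_neighbor (Ne.symm hkv) h1 h2
    obtain ⟨t, -, rfl⟩ := vtx_adj_iff.1 hs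
    exact hz _ (smul_vtx_eq_iff.1 hgs)
  refine h.map hf (fun k hk => hS ▸ hcent k hk) fun k hk => ?_
  rw [← hS, ← inv_mem_iff, ← smul_vtx_one_iff]
  by_contra hkv
  obtain ⟨w, hwc, hw1, hkw⟩ := mem_dSet_iff.1 hk
  have h1 : w • vtx S false 1 = vtx S false 1 := smul_vtx_one_iff.2 (hcent w hwc)
  have h2 : w • k⁻¹ • vtx S false 1 = k⁻¹ • vtx S false 1 := by
    have h3 := smul_vtx_one_iff.2 (hcent _ hkw)
    rw [mul_smul, mul_smul, smul_eq_iff_eq_inv_smul] at h3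
    exact h3
  obtain ⟨s, hs, hws⟩ := hT.exists_fixed_neighbor (Ne.symm hkv) h1 h2
  obtain ⟨t, ht, rfl⟩ := vtx_adj_iff.1 hs
  have hws' := smul_vtx_eq_iff.1 hws
  have hwG := hcent w hwc
  rw [hS] at ht hwG
  obtain ⟨a, rfl⟩ := ht
  obtain ⟨w, rfl⟩ := hwG
  have hwc' : w ∈ cent g := by
    rw [mem_cent_iff] at hwc ⊢
    exact hf (by simpa using hwc)
  have hn : f (a⁻¹ * w * a) ∈ N := hw w hwc' a (by simpa using hws')
  obtain ⟨-, hn'⟩ := hN _ hn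
  obtain ⟨p, hp, hp'⟩ := hne
  refine hz (1 * f a) ((smul_vtx_eq_iff (b := true)).1 (hT.smul_center hw1 (g := f g)
    (mem_cent_iff.1 hwc).symm
    (bassSerre_adj_vtx true (1 * f a)) (vtx_adj_iff.2 ⟨p, hp, rfl⟩) ?_ hws ?_ ?_))
  · rw [Ne, vtx_eq_iff]
    simpa using hp'
  · rw [smul_vtx_eq_iff]
    simpa using hn' 1 (one_mem _)
  · rw [smul_vtx_eq_iff]
    simpa [mul_assoc] using hn' p hp

/-- If `S false ⊓ S true` is normal in `S true`, then `S true` is malnormal. -/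
theorem mem_of_conj_mem (hT : TreeAction K (bassSerre S) Sigma.fst)
    (hN : ∀ w ∈ S true, w ∈ S false → ∀ b ∈ S true, b⁻¹ * w * b ∈ S false)
    (hne : ∃ p ∈ S true, p ∉ S false) {w k : K} (hw1 : w ≠ 1) (hw : w ∈ S true)
    (hkw : k * w * k⁻¹ ∈ S true) : k ∈ S true := by
  rw [← inv_mem_iff, ← smul_vtx_one_iff]
  by_contra hkv
  have h1 : w • vtx S true 1 = vtx S true 1 := smul_vtx_one_iff.2 hw
  have h2 : w • k⁻¹ • vtx S true 1 = k⁻¹ • vtx S true 1 := by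
    have h3 := smul_vtx_one_iff.2 hkw
    rw [mul_smul, mul_smul, smul_eq_iff_eq_inv_smul] at h3
    exact h3
  obtain ⟨s, hs, hws⟩ := hT.exists_fixed_neighbor (Ne.symm hkv) h1 h2
  obtain ⟨t, ht, rfl⟩ := vtx_adj_iff.1 hs
  have hws' : t⁻¹ * w * t ∈ S false := by simpa using smul_vtx_eq_iff.1 hws
  -- By normality, `w` fixes every neighbour of the base vertex as soon as it fixes one; this vertex
  -- is then a centre of `w` and admits no other fixed vertex of its colour.
  have hall : ∀ b ∈ S true, b⁻¹ * w * b ∈ S false := by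
    intro b hb
    have := hN _ (mul_mem (mul_mem (inv_mem ht) hw) ht) hws' (t⁻¹ * b) (mul_mem (inv_mem ht) hb)
    simpa [mul_assoc] using this
  obtain ⟨p, hp, hp'⟩ := hne
  refine hkv (hT.eq_center hw1 (bassSerre_adj_vtx true 1) (vtx_adj_iff.2 ⟨p, hp, rfl⟩) ?_ h1 ?_ ?_
    h2 rfl).symm
  · rw [Ne, vtx_eq_iff]
    simpa using hp'
  · rw [smul_vtx_eq_iff]
    simpa using hall 1 (one_mem _)
  · rw [smul_vtx_eq_iff]
    simpa using hall p hp

end Elliptic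

/-! ### Amalgams of `G` and `P` over a subgroup of `G`. -/

section AmalgamOver

open Monoid

variable {π : Set Nat.Primes} {G P : Type u} [Group G] [Group P] {D : Subgroup G} {e : D →* P}

/-- The natural map of the first factor into the amalgamated product. -/
def amalgamInl (e : D →* P) : G →* Amalgam D.subtype e :=
  PushoutI.of (φ := amalgamMap D.subtype e) false

/-- The natural map of the second factor into the amalgamated product. -/
def amalgamInr (e : D →* P) : P →* Amalgam D.subtype e :=
  PushoutI.of (φ := amalgamMap D.subtype e) true

/-- The images of the two factors in the amalgamated product. -/
def amalgamRange (e : D →* P) : Bool → Subgroup (Amalgam D.subtype e)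
  | false => (amalgamInl e).range
  | true => (amalgamInr e).range

theorem amalgamMap_injective (he : Function.Injective e) (b : Bool) :
    Function.Injective (amalgamMap D.subtype e b) :=
  match b with
  | false => D.subtype_injective
  | true => he

theorem amalgamInl_injective (he : Function.Injective e) : Function.Injective (amalgamInl e) :=
  PushoutI.of_injective (amalgamMap_injective he) false

theorem amalgamInr_injective (he : Function.Injective e) : Function.Injective (amalgamInr e) :=
  PushoutI.of_injective (amalgamMap_injective he) true

theorem amalgamInl_coe (d : D) : amalgamInl e d = amalgamInr e (e d) :=
  (PushoutI.of_apply_eq_base (amalgamMap D.subtype e) false d).trans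
    (PushoutI.of_apply_eq_base (amalgamMap D.subtype e) true d).symm

theorem isAmalgam_amalgamRange (he : Function.Injective e) : IsAmalgam (amalgamRange e) := by
  have h := isAmalgam_pushoutI (amalgamMap_injective he)
  have hS : amalgamRange e = fun b => (PushoutI.of (φ := amalgamMap D.subtype e) b).range := by
    funext b
    cases b <;> rfl
  rw [hS]
  exact h

theorem exists_of_amalgamInl_eq (he : Function.Injective e) {g : G} {p : P}
    (h : amalgamInl e g = amalgamInr e p) : ∃ d : D, (d : G) = g ∧ e d = p := by
  have h1 : amalgamInl e g ∈ (PushoutI.base (amalgamMap D.subtype e)).range := by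
    rw [← PushoutI.inf_of_range_eq_base_range (amalgamMap_injective he)
      (show false ≠ true by simp)]
    exact ⟨⟨g, rfl⟩, ⟨p, h.symm⟩⟩
  obtain ⟨d, hd⟩ := h1
  have h2 : amalgamInl e d = amalgamInl e g :=
    (PushoutI.of_apply_eq_base (amalgamMap D.subtype e) false d).trans hd
  refine ⟨d, amalgamInl_injective he h2, amalgamInr_injective he ?_⟩
  rw [← amalgamInl_coe, h2, h]

theorem amalgamInl_mem_iff (he : Function.Injective e) {g : G} :
    amalgamInl e g ∈ amalgamRange e true ↔ g ∈ D := by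
  constructor
  · rintro ⟨p, hp⟩
    obtain ⟨d, rfl, -⟩ := exists_of_amalgamInl_eq he hp.symm
    exact d.2
  · intro hg
    exact ⟨e ⟨g, hg⟩, (amalgamInl_coe ⟨g, hg⟩).symm⟩

theorem amalgamInr_mem_iff (he : Function.Injective e) {p : P} :
    amalgamInr e p ∈ amalgamRange e false ↔ p ∈ e.range := by
  constructor
  · rintro ⟨g, hg⟩
    obtain ⟨d, -, rfl⟩ := exists_of_amalgamInl_eq he hg
    exact ⟨d, rfl⟩
  · rintro ⟨d, rfl⟩
    exact ⟨d, amalgamInl_coe d⟩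

/-- In `G` the subgroup `C ≤ D` meets the conjugates of `D` by elements outside `D` trivially; in
`P` it lies in every conjugate of `D` and contains the intersection of any two of them. -/
structure AmalgamData (e : D →* P) (C : Subgroup G) : Prop where
  injective : Function.Injective e
  le : C ≤ D
  ne : ∃ p : P, p ∉ e.range
  mem_of_conj : ∀ (d : D) (b : P), b ∉ e.range → b⁻¹ * e d * b ∈ e.range → (d : G) ∈ C
  eq_one_of_conj : ∀ c ∈ C, ∀ a : G, a ∉ D → a * c * a⁻¹ ∈ D → c = 1
  normal : ∀ d : D, (d : G) ∈ C → ∀ b : P, b⁻¹ * e d * b ∈ e.range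

theorem AmalgamData.treeAction {C : Subgroup G} (h : AmalgamData e C) :
    TreeAction (Amalgam D.subtype e) (bassSerre (amalgamRange e)) Sigma.fst := by
  refine (isAmalgam_amalgamRange h.injective).treeAction ?_
  rintro _ _ _ ⟨a, rfl⟩ ha ⟨b, rfl⟩ hb ⟨g, rfl⟩ hg hag hbg
  rw [amalgamInl_mem_iff h.injective] at ha hg
  rw [amalgamInr_mem_iff h.injective] at hb
  rw [← map_inv, ← map_mul, ← map_mul, amalgamInl_mem_iff h.injective] at hag
  have e1 : amalgamInl e g = amalgamInr e (e ⟨g, hg⟩) := amalgamInl_coe ⟨g, hg⟩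
  rw [e1, ← map_inv, ← map_mul, ← map_mul, amalgamInr_mem_iff h.injective] at hbg
  rw [h.eq_one_of_conj g (h.mem_of_conj ⟨g, hg⟩ b hb hbg) a ha hag, map_one]

theorem AmalgamData.exists_mem {C : Subgroup G} (h : AmalgamData e C) :
    ∃ p ∈ amalgamRange e true, p ∉ amalgamRange e false := by
  obtain ⟨p, hp⟩ := h.ne
  exact ⟨amalgamInr e p, ⟨p, rfl⟩, fun h' => hp ((amalgamInr_mem_iff h.injective).1 h')⟩

/-- This leaves only the elements of `P` to the two cases: an element of `G` conjugate into `P` is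
handled by `hcond`, and any other by `centCond_map_of_not_conj` with the image of `C` as `N`. -/
theorem AmalgamData.inP {C : Subgroup G} (h : AmalgamData e C) (hG : InP π G)
    (hP : IsUGroup π P) (hfin : ∀ d ∈ D, d ∉ C → IsOfFinOrder d)
    (hcond : ∀ p : P, LacksRoot π (amalgamInr e p) → CentCond π (amalgamInr e p)) :
    InP π (Amalgam D.subtype e) := by
  refine inP_of_treeAction h.treeAction ?_ ?_
  · rintro (_ | _) m hm _ ⟨g, rfl⟩ _ ⟨g', rfl⟩ E <;> rw [← map_pow, ← map_pow] at E
    · rw [hG.isUGroup.eq_of_pow hm (amalgamInl_injective h.injective E)]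
    · rw [hP.eq_of_pow hm (amalgamInr_injective h.injective E)]
  · rintro (_ | _) _ ⟨g, rfl⟩ hz
    swap
    · exact hcond g hz
    by_cases hconj : ∃ k, k⁻¹ * amalgamInl e g * k ∈ amalgamRange e true
    · obtain ⟨k, p, hp⟩ := hconj
      have h1 : LacksRoot π (amalgamInr e p) := by
        rw [hp]
        simpa using hz.conj k⁻¹
      have h2 := (hcond p h1).conj k
      have E : k * amalgamInr e p * k⁻¹ = amalgamInl e g := by rw [hp]; group
      rwa [E] at h2
    have hg : CentCond π g := hG.cond g hz.of_map
    refine centCond_map_of_not_conj h.treeAction (amalgamInl_injective h.injective) rfl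
      h.exists_mem (N := C.map (amalgamInl e)) ?_ (fun k hk => hconj ⟨k, hk⟩) ?_ hg
    · rintro _ ⟨c, hc, rfl⟩
      refine ⟨(amalgamInl_mem_iff h.injective).2 (h.le hc), ?_⟩
      rintro _ ⟨b, rfl⟩
      have e1 : amalgamInl e c = amalgamInr e (e ⟨c, h.le hc⟩) := amalgamInl_coe ⟨c, h.le hc⟩
      rw [e1, ← map_inv, ← map_mul, ← map_mul, amalgamInr_mem_iff h.injective]
      exact h.normal ⟨c, h.le hc⟩ hc b
    · intro w hw a hwa
      rw [amalgamInl_mem_iff h.injective] at hwa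
      refine ⟨_, ?_, rfl⟩
      by_contra hC
      -- Outside `C` the conjugate of `w` would have finite order, while the centralizer of `g` is
      -- torsion-free.
      have h1 := hfin _ hwa hC
      have h2 : IsOfFinOrder w := by
        have h3 := (MulAut.conj a).toMonoidHom.isOfFinOrder h1
        simpa [mul_assoc] using h3
      rw [hg.1 w hw h2] at hC
      exact hC (by simp)

/-- A nontrivial central element of `P` satisfies the condition in the amalgamated product if `P`
is torsion-free and `D` is normal in `P`. -/
theorem AmalgamData.centCond_of_central (h : AmalgamData e D) {p : P} (hp1 : p ≠ 1)
    (hp : ∀ q : P, q * p = p * q) (htf : ∀ q : P, IsOfFinOrder q → q = 1) :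
    CentCond π (amalgamInr e p) := by
  have hinj := amalgamInr_injective h.injective
  have hN : ∀ w ∈ amalgamRange e true, w ∈ amalgamRange e false → ∀ b ∈ amalgamRange e true,
      b⁻¹ * w * b ∈ amalgamRange e false := by
    rintro _ ⟨w, rfl⟩ hw _ ⟨b, rfl⟩
    rw [amalgamInr_mem_iff h.injective] at hw
    obtain ⟨d, rfl⟩ := hw
    rw [← map_inv, ← map_mul, ← map_mul, amalgamInr_mem_iff h.injective]
    exact h.normal d d.2 b
  have hmal : ∀ w k, w ≠ 1 → w ∈ amalgamRange e true → k * w * k⁻¹ ∈ amalgamRange e true →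
      k ∈ amalgamRange e true := fun w k => mem_of_conj_mem h.treeAction hN h.exists_mem
  have hcent : ∀ k ∈ cent (amalgamInr e p), k ∈ (amalgamInr e).range := by
    intro k hk
    refine hmal (amalgamInr e p) k (fun E => hp1 (hinj (by rw [E, map_one]))) ⟨p, rfl⟩ ?_
    rw [mem_cent_iff.1 hk, mul_inv_cancel_right]
    exact ⟨p, rfl⟩
  refine CentCond.map hinj hcent ?_ ⟨fun c _ hc => htf c hc, Or.inl ?_⟩
  · intro k hk
    obtain ⟨w, hw, hw1, hkw⟩ := mem_dSet_iff.1 hk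
    exact hmal w k hw1 (hcent w hw) (hcent _ hkw)
  · ext q
    rw [mem_dSet_iff, SetLike.mem_coe]
    exact ⟨fun _ => mem_cent_iff.2 (hp q),
      fun _ => ⟨p, self_mem_cent p, hp1, mem_cent_iff.2 (hp _)⟩⟩

end AmalgamOver
-- Divisibility and rank one of `ℤ_π`.
section LocalInt

variable {π : Set Nat.Primes}

/-- The element `1` of the additive group of `ℤ_π`, written multiplicatively. -/
def localGen (π : Set Nat.Primes) : Multiplicative (localInt π) := Multiplicative.ofAdd 1

theorem localInt_pow_injective {n : ℕ} (hn : n ≠ 0) {z w : Multiplicative (localInt π)}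
    (h : z ^ n = w ^ n) : z = w := by
  have h1 : ((n • z.toAdd : localInt π) : ℚ) = ((n • w.toAdd : localInt π) : ℚ) :=
    congrArg Subtype.val h
  push_cast at h1
  simp only [nsmul_eq_mul] at h1
  exact Subtype.ext (mul_left_cancel₀ (Nat.cast_ne_zero.2 hn) h1)

theorem localInt_zpow_injective {n : ℤ} (hn : n ≠ 0) {z w : Multiplicative (localInt π)}
    (h : z ^ n = w ^ n) : z = w := by
  refine localInt_pow_injective (Int.natAbs_ne_zero.2 hn) ?_
  rcases Int.natAbs_eq n with e | e <;> rw [e] at h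
  · rwa [zpow_natCast, zpow_natCast] at h
  · rwa [zpow_neg, zpow_neg, inv_inj, zpow_natCast, zpow_natCast] at h

theorem localInt_exists_pow (z : Multiplicative (localInt π)) :
    ∃ b, IsPrimeTo π b ∧ ∃ a : ℤ, z ^ b = localGen π ^ a := by
  obtain ⟨b, hb, a, e⟩ := z.toAdd.2
  refine ⟨b, hb, a, Subtype.ext ?_⟩
  change ((b • z.toAdd : localInt π) : ℚ) = ((a • (1 : localInt π) : localInt π) : ℚ)
  push_cast
  rw [e]
  have : (b : ℚ) ≠ 0 := Nat.cast_ne_zero.2 hb.1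
  simp
  field_simp

theorem localInt_exists_root {m : ℕ} (hm : IsPrimeTo π m) (z : Multiplicative (localInt π)) :
    ∃ w, w ^ m = z := by
  obtain ⟨b, hb, a, e⟩ := z.toAdd.2
  refine ⟨Multiplicative.ofAdd ⟨(a : ℚ) / ((m * b : ℕ) : ℚ), m * b, hm.mul hb, a, rfl⟩,
    Subtype.ext ?_⟩
  change ((m • (⟨(a : ℚ) / ((m * b : ℕ) : ℚ), _⟩ : localInt π) : localInt π) : ℚ) =
    ((z.toAdd : localInt π) : ℚ)
  rw [e]
  have h1 : (b : ℚ) ≠ 0 := Nat.cast_ne_zero.2 hb.1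
  have h2 : (m : ℚ) ≠ 0 := Nat.cast_ne_zero.2 hm.1
  push_cast
  simp only [nsmul_eq_mul]
  field_simp

theorem localGen_ne_one : localGen π ≠ 1 := by
  intro h
  exact one_ne_zero (α := localInt π) h

end LocalInt

/-! ### Roots in `G`, and the structure of `D` when the index is two. -/

section Roots

variable {π : Set Nat.Primes} {G : Type u} [Group G]

theorem IsUGroup.commute_of_pow_left (hU : IsUGroup π G) {m : ℕ} (hm : IsPrimeTo π m) {c y : G}
    (h : Commute (c ^ m) y) : Commute c y := by
  have h1 : (y * c * y⁻¹) ^ m = c ^ m := by rw [conj_pow, ← h.eq, mul_inv_cancel_right]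
  exact (mul_inv_eq_iff_eq_mul.1 (hU.eq_of_pow hm h1)).symm

theorem mem_of_conj_mem_cent {x c a : G} (hc : c ∈ cent x) (hc1 : c ≠ 1)
    (h : a * c * a⁻¹ ∈ cent x) : a ∈ dSet x :=
  mem_dSet_iff.2 ⟨c, hc, hc1, h⟩

theorem pow_eq_one_of_injective {x : G} {i : cent x →* Multiplicative (localInt π)}
    (hi : Function.Injective i) {c : G} (hc : c ∈ cent x) {n : ℕ} (hn : n ≠ 0) (h : c ^ n = 1) :
    c = 1 := by
  have h1 : i ⟨c, hc⟩ ^ n = 1 ^ n := by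
    rw [← map_pow, one_pow, ← map_one i]
    congr 1
    exact Subtype.ext h
  have h2 := localInt_pow_injective hn h1
  rw [← map_one i] at h2
  exact congrArg Subtype.val (hi h2)

theorem commute_of_injective {x : G} {i : cent x →* Multiplicative (localInt π)}
    (hi : Function.Injective i) {c d : G} (hc : c ∈ cent x) (hd : d ∈ cent x) : c * d = d * c := by
  have : (⟨c, hc⟩ : cent x) * ⟨d, hd⟩ = ⟨d, hd⟩ * ⟨c, hc⟩ := hi (by rw [map_mul, map_mul, mul_comm])
  exact congrArg Subtype.val this

variable {x : G} {D : Subgroup G}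

theorem IndexTwo.exists_notMem (h : IndexTwo x D) : ∃ d ∈ D, d ∉ cent x := by
  by_contra hall
  have h1 : (cent x).relIndex D = 1 := Subgroup.relIndex_eq_one.2 fun d hd => by
    by_contra hd'
    exact hall ⟨d, hd, hd'⟩
  rw [h.relIndex_eq] at h1
  omega

theorem IndexTwo.mul_mem_cent (h : IndexTwo x D) {d t : G} (hd : d ∈ D) (hdc : d ∉ cent x)
    (ht : t ∈ D) (htc : t ∉ cent x) : d * t ∈ cent x := by
  have h1 : ((cent x).subgroupOf D).index = 2 := h.relIndex_eq
  have h2 := Subgroup.mul_mem_iff_of_index_two h1 (a := ⟨d, hd⟩) (b := ⟨t, ht⟩)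
  have h3 : (⟨d, hd⟩ * ⟨t, ht⟩ : D) ∈ (cent x).subgroupOf D := h2.2 (by
    rw [Subgroup.mem_subgroupOf, Subgroup.mem_subgroupOf]
    exact ⟨fun h => absurd h hdc, fun h => absurd h htc⟩)
  exact h3

/-- The elements of `D` outside the centralizer of `x` invert the centralizer. -/
theorem IndexTwo.conj_eq_inv (h : IndexTwo x D) {i : cent x →* Multiplicative (localInt π)}
    (hi : Function.Injective i) {d c : G} (hd : d ∈ D) (hdc : d ∉ cent x) (hc : c ∈ cent x) :
    d * c * d⁻¹ = c⁻¹ := by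
  have hcα : d * c * d⁻¹ ∈ cent x := h.conj_mem ⟨d, hd⟩ ⟨c, hc⟩
  have hxα : d * x * d⁻¹ ∈ cent x := h.conj_mem ⟨d, hd⟩ ⟨x, self_mem_cent x⟩
  have hdd : d * d ∈ cent x := h.mul_mem_cent hd hdc hd hdc
  -- The norm of `c` under `d`. It is fixed by `d`, because `d * d` lies in the abelian centralizer.
  set y := c * (d * c * d⁻¹) with hy
  have hyc : y ∈ cent x := mul_mem hc hcα
  have hdy : d * y * d⁻¹ = y := by
    have e1 : d * y * d⁻¹ = (d * c * d⁻¹) * ((d * d) * c * (d * d)⁻¹) := by rw [hy]; group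
    rw [e1, commute_of_injective hi hdd hc, mul_inv_cancel_right, commute_of_injective hi hcα hc]
  by_cases hy1 : y = 1
  · exact (inv_eq_of_mul_eq_one_right hy1).symm
  exfalso
  -- The centralizer has rank one, so if `y ≠ 1`, a nonzero power of `x` is a power of `y`. Then `d`
  -- fixes that power, hence `x` itself, against the choice of `d`.
  obtain ⟨b, hb, a, ha⟩ := localInt_exists_pow (i ⟨y, hyc⟩)
  obtain ⟨b', hb', a', ha'⟩ := localInt_exists_pow (i ⟨x, self_mem_cent x⟩)
  have hab : a ≠ 0 := by
    rintro rfl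
    rw [zpow_zero] at ha
    refine hy1 (pow_eq_one_of_injective hi hyc hb.1 ?_)
    rw [← map_pow, ← map_one i] at ha
    exact congrArg Subtype.val (hi ha)
  have e1 : y ^ ((b : ℤ) * a') = x ^ ((b' : ℤ) * a) := by
    have e2 : (⟨y, hyc⟩ : cent x) ^ ((b : ℤ) * a') = ⟨x, self_mem_cent x⟩ ^ ((b' : ℤ) * a) := by
      apply hi
      rw [map_zpow, map_zpow, zpow_mul, zpow_mul, zpow_natCast, zpow_natCast, ha, ha', ← zpow_mul,
        ← zpow_mul, mul_comm]
    exact congrArg Subtype.val e2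
  have e3 : (d * x * d⁻¹) ^ ((b' : ℤ) * a) = x ^ ((b' : ℤ) * a) := by
    rw [conj_zpow, ← e1, ← conj_zpow, hdy]
  have e4 : (⟨_, hxα⟩ : cent x) = ⟨x, self_mem_cent x⟩ := by
    refine hi (localInt_zpow_injective (n := (b' : ℤ) * a)
      (mul_ne_zero (by exact_mod_cast hb'.1) hab) ?_)
    rw [← map_zpow, ← map_zpow]
    congr 1
    exact Subtype.ext e3
  exact hdc (mem_cent_iff.2 (mul_inv_eq_iff_eq_mul.1 (congrArg Subtype.val e4)))

/-- The element `d * d` is inverted by `d` and also commutes with it, so its square is `1`; the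
centralizer is torsion-free. -/
theorem IndexTwo.mul_self_eq_one (h : IndexTwo x D) {i : cent x →* Multiplicative (localInt π)}
    (hi : Function.Injective i) {d : G} (hd : d ∈ D) (hdc : d ∉ cent x) : d * d = 1 := by
  have hdd : d * d ∈ cent x := h.mul_mem_cent hd hdc hd hdc
  have h1 := h.conj_eq_inv hi hd hdc hdd
  have h2 : d * (d * d) * d⁻¹ = d * d := by group
  rw [h2] at h1
  refine pow_eq_one_of_injective hi hdd two_ne_zero ?_
  rw [pow_two]
  nth_rewrite 1 [h1]
  rw [inv_mul_cancel]

end Roots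

/-! ### The central product of `C` and `ℤ_π`. -/

section Central

variable {π : Set Nat.Primes} {G : Type u} [Group G] {x : G}

/-- From `D = C` it follows that `cent c ≤ cent x` and that `dSet c` is `cent x`. Alternative (a)
for `c` makes `c` central. Alternative (b) would give an element of `cent x` that inverts `x`,
although it commutes with `x` and `x ^ 2 ≠ 1`. -/
theorem central_of_lacksRoot (hG : InP π G) (hx : LacksRoot π x)
    (hd : dSet x = (cent x : Set G)) {c : G} (hc : c ∈ cent x) (hcr : LacksRoot π c) {q : G}
    (hq : q ∈ cent x) : q * c = c * q := by
  have hx1 : x ≠ 1 := hx.ne_one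
  have mem_of : ∀ w a : G, w ∈ cent x → w ≠ 1 → a * w * a⁻¹ ∈ cent x → a ∈ cent x := by
    intro w a hw hw1 h
    have := mem_of_conj_mem_cent hw hw1 h
    rwa [hd] at this
  have hle : cent c ≤ cent x := by
    intro a ha
    refine mem_of c a hc hcr.ne_one ?_
    rwa [mem_cent_iff.1 ha, mul_inv_cancel_right]
  have hxc : x ∈ cent c := mem_cent_iff.2 (mem_cent_iff.1 hc).symm
  have hdc : dSet c = (cent x : Set G) := by
    ext a
    rw [mem_dSet_iff, SetLike.mem_coe]
    constructor
    · rintro ⟨w, hw, hw1, haw⟩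
      exact mem_of w a (hle hw) hw1 (hle haw)
    · intro ha
      refine ⟨x, hxc, hx1, ?_⟩
      rwa [mem_cent_iff.1 ha, mul_inv_cancel_right]
  rcases (hG.cond c hcr).2 with h | ⟨⟨D, hD⟩, i, hi⟩
  · have h1 : q ∈ dSet c := by rw [hdc]; exact hq
    rw [h] at h1
    exact mem_cent_iff.1 h1
  · exfalso
    obtain ⟨d, hdD, hdc'⟩ := hD.exists_notMem
    have h1 := hD.conj_eq_inv hi hdD hdc' hxc
    have h2 : d ∈ cent x := by
      have h3 : d ∈ (D : Set G) := hdD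
      rw [hD.coe_eq, hdc] at h3
      exact h3
    rw [mem_cent_iff.1 h2, mul_inv_cancel_right] at h1
    refine hx1 (pow_eq_one_of_injective hi hxc two_ne_zero ?_)
    rw [pow_two]
    nth_rewrite 1 [h1]
    rw [inv_mul_cancel]

variable (hU : IsUGroup π G) (hx : ¬ IsOfFinOrder x)

/-- The natural map of `ℤ_π` into the central product. -/
noncomputable def centralInr : Multiplicative (localInt π) →* CentralProd hU hx :=
  (QuotientGroup.mk' (centralKernel hU hx)).comp
    (MonoidHom.inr (cent x) (Multiplicative (localInt π)))

theorem centralProd_exists (p : CentralProd hU hx) :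
    ∃ c z, p = centralEmb hU hx c * centralInr hU hx z := by
  obtain ⟨⟨c, z⟩, rfl⟩ := QuotientGroup.mk_surjective p
  refine ⟨c, z, ?_⟩
  rw [centralEmb, centralInr, MonoidHom.comp_apply, MonoidHom.comp_apply, ← map_mul]
  simp

theorem centralInr_commute (z : Multiplicative (localInt π)) (p : CentralProd hU hx) :
    Commute (centralInr hU hx z) p := by
  obtain ⟨⟨c, w⟩, rfl⟩ := QuotientGroup.mk_surjective p
  refine (show Commute (MonoidHom.inr (cent x) (Multiplicative (localInt π)) z) (c, w) from
    ?_).map (QuotientGroup.mk' (centralKernel hU hx))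
  simp [Commute, SemiconjBy, mul_comm]

theorem centralEmb_injective : Function.Injective (centralEmb hU hx) := by
  rw [injective_iff_map_eq_one]
  intro c hc
  have h1 : ((c, 1) : cent x × Multiplicative (localInt π)) ∈ centralKernel hU hx :=
    (QuotientGroup.eq_one_iff _).1 hc
  obtain ⟨y, hy⟩ := h1
  rw [Prod.ext_iff] at hy
  obtain ⟨rfl, h2⟩ := hy
  obtain ⟨b, hb, a, e⟩ := y.2
  have h3 : exponentVal hU y⁻¹ = 0 := h2.symm
  have h4 := exponentVal_eq hU hx y⁻¹ hb (a := -a) (by simp [e])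
  rw [h3] at h4
  have h5 : a = 0 := by
    have h6 : (b : ℚ) ≠ 0 := Nat.cast_ne_zero.2 hb.1
    have h7 : ((-a : ℤ) : ℚ) = 0 := by
      rcases div_eq_zero_iff.1 h4.symm with h | h
      · exact h
      · exact absurd h h6
    have : -a = 0 := by exact_mod_cast h7
    omega
  rw [h5, zpow_zero] at e
  exact Subtype.ext (hU.eq_of_pow hb (e.trans (one_pow b).symm))

theorem centralEmb_eq {c : cent x} {z : Multiplicative (localInt π)} {b : ℕ} {a : ℤ}
    (hb : IsPrimeTo π b) (hc : (c : G) ^ b = x ^ a) (hz : z ^ b = localGen π ^ a) :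
    centralEmb hU hx c = centralInr hU hx z := by
  let y : rootSubgroup hU x := ⟨c, b, hb, a, hc⟩
  have h1 : exponentHom hU hx y = z := by
    refine localInt_pow_injective hb.1 ?_
    rw [hz]
    refine Subtype.ext ?_
    change ((b • exponentVal hU y : localInt π) : ℚ) = ((a • (1 : localInt π) : localInt π) : ℚ)
    push_cast
    rw [exponentVal_eq hU hx y hb hc]
    have : (b : ℚ) ≠ 0 := Nat.cast_ne_zero.2 hb.1
    simp
    field_simp
  rw [← mul_inv_eq_one, ← map_inv]
  have h2 : (c, z⁻¹) ∈ centralKernel hU hx := ⟨y, by rw [map_inv, h1]⟩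
  have h3 := (QuotientGroup.eq_one_iff (N := centralKernel hU hx) (c, z⁻¹)).2 h2
  rw [← h3, centralEmb, centralInr, MonoidHom.comp_apply, MonoidHom.comp_apply, ← map_mul]
  simp

theorem centralInr_gen : centralInr hU hx (localGen π) =
    centralEmb hU hx ⟨x, self_mem_cent x⟩ :=
  (centralEmb_eq hU hx (isPrimeTo_one π) (a := 1) (by simp) (by simp)).symm

theorem centralInr_pow {z : Multiplicative (localInt π)} {b : ℕ} {a : ℤ}
    (hz : z ^ b = localGen π ^ a) :
    centralInr hU hx z ^ b = centralEmb hU hx (⟨x, self_mem_cent x⟩ ^ a) := by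
  rw [← map_pow, hz, map_zpow, map_zpow, centralInr_gen]

/-- A suitable `π'`-power of any element lies in `C`: `(c * z) ^ b = c ^ b * x ^ a`. If this is
trivial, then `c ∈ R` and `z` cancels `c` in the quotient. -/
theorem centralProd_torsionFree (htf : ∀ c ∈ cent x, IsOfFinOrder c → c = 1)
    (p : CentralProd hU hx) (hp : IsOfFinOrder p) : p = 1 := by
  obtain ⟨c, z, rfl⟩ := centralProd_exists hU hx p
  obtain ⟨n, hn, e⟩ := isOfFinOrder_iff_pow_eq_one.1 hp
  obtain ⟨b, hb, a, hz⟩ := localInt_exists_pow z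
  have hcomm := (centralInr_commute hU hx z (centralEmb hU hx c)).symm
  have h1 : centralEmb hU hx ((c ^ b * ⟨x, self_mem_cent x⟩ ^ a) ^ n) = 1 := by
    rw [map_pow, map_mul, map_pow, ← centralInr_pow hU hx hz, ← hcomm.mul_pow, ← pow_mul,
      mul_comm b n, pow_mul, e, one_pow]
  rw [← map_one (centralEmb hU hx)] at h1
  have h2 := congrArg Subtype.val (centralEmb_injective hU hx h1)
  have h3 := htf _ (c ^ b * ⟨x, self_mem_cent x⟩ ^ a : cent x).2
    (isOfFinOrder_iff_pow_eq_one.2 ⟨n, hn, h2⟩)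
  have h4 : (c : G) ^ b = x ^ (-a) := by
    rw [zpow_neg]
    exact eq_inv_of_mul_eq_one_left h3
  rw [centralEmb_eq hU hx hb h4 (z := z⁻¹) (by rw [inv_pow, hz, zpow_neg]), map_inv,
    inv_mul_cancel]

/-- With `u = z * w⁻¹`, the hypothesis becomes `c ^ m * u ^ m = d ^ m`. Then `c` and `d` commute, by
uniqueness of roots in `G`. Raising to the power `b` replaces `u` by a power of `x`, and uniqueness
of roots in `G` shows that `c⁻¹ * d` lies in `R` and is identified with `u`. -/
theorem centralProd_isUGroup : IsUGroup π (CentralProd hU hx) := by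
  intro m hm p q hpq
  change p ^ m = q ^ m at hpq
  obtain ⟨c, z, rfl⟩ := centralProd_exists hU hx p
  obtain ⟨d, w, rfl⟩ := centralProd_exists hU hx q
  obtain ⟨b, hb, a, hz⟩ := localInt_exists_pow (z * w⁻¹)
  set E := centralEmb hU hx
  set J := centralInr hU hx
  have hJ : ∀ z p, Commute (J z) p := centralInr_commute hU hx
  have h1 : E c ^ m * J (z * w⁻¹) ^ m = E d ^ m := by
    rw [(hJ z _).symm.mul_pow, (hJ w _).symm.mul_pow] at hpq
    rw [map_mul, map_inv, (hJ z _).mul_pow, ← mul_assoc, hpq, inv_pow, mul_inv_cancel_right]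
  have hcd : Commute (c : G) (d : G) := by
    refine hU.commute_of_pow_left hm (hU.commute_of_pow_left hm ?_).symm
    have h2 : Commute (E c ^ m) (E d ^ m) := by
      rw [← h1]
      exact (Commute.refl _).mul_right ((hJ _ _).symm.pow_right m)
    rw [← map_pow, ← map_pow] at h2
    have h3 : c ^ m * d ^ m = d ^ m * c ^ m :=
      centralEmb_injective hU hx (by rw [map_mul, map_mul]; exact h2)
    exact (congrArg Subtype.val h3).symm
  have h4 : E ((c ^ b * ⟨x, self_mem_cent x⟩ ^ a) ^ m) = E ((d ^ b) ^ m) := by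
    rw [← (hJ _ _).symm.mul_pow] at h1
    rw [map_pow, map_mul, map_pow, ← centralInr_pow hU hx hz, map_pow, map_pow]
    change (E c ^ b * J (z * w⁻¹) ^ b) ^ m = _
    rw [← (hJ _ _).symm.mul_pow, pow_right_comm, h1, pow_right_comm]
  have h5 := congrArg Subtype.val (centralEmb_injective hU hx h4)
  have h6 : (c : G) ^ b * x ^ a = (d : G) ^ b := hU.eq_of_pow hm h5
  have h7 : ((c⁻¹ * d : cent x) : G) ^ b = x ^ a := by
    change ((c : G)⁻¹ * d) ^ b = x ^ a
    rw [hcd.inv_left.mul_pow, ← h6, inv_pow, inv_mul_cancel_left]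
  have h8 := centralEmb_eq hU hx hb h7 hz
  change E _ = J _ at h8
  have h9 : E d = E c * J (z * w⁻¹) := by rw [← h8, map_mul, map_inv, mul_inv_cancel_left]
  rw [h9, mul_assoc, ← map_mul, inv_mul_cancel_right]

end Central
-- The case `D = C`.
section CentralCase

variable {π : Set Nat.Primes} {G : Type u} [Group G] {x : G}

theorem central_amalgamData (hG : InP π G) (hx : LacksRoot π x)
    (hd : dSet x = (cent x : Set G)) :
    AmalgamData (centralEmb hG.isUGroup (hG.not_isOfFinOrder hx)) (cent x) where
  injective := centralEmb_injective _ _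
  le := le_rfl
  ne := by
    -- An `m`-th root of the generator of `ℤ_π` lies outside `C`, because `x` has no such root
    -- there.
    obtain ⟨m, hm, hr⟩ := id hx
    obtain ⟨w, hw⟩ := localInt_exists_root hm (localGen π)
    refine ⟨centralInr _ _ w, ?_⟩
    rintro ⟨c, hc⟩
    have h1 : centralEmb hG.isUGroup (hG.not_isOfFinOrder hx) (c ^ m) =
        centralEmb _ _ ⟨x, self_mem_cent x⟩ := by
      rw [map_pow, hc, ← map_pow, hw, centralInr_gen]
    exact hr c (congrArg Subtype.val (centralEmb_injective _ _ h1))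
  mem_of_conj d _ _ _ := d.2
  eq_one_of_conj c hc a ha h := by
    by_contra hc1
    have := mem_of_conj_mem_cent hc hc1 h
    rw [hd] at this
    exact ha this
  normal d _ b := by
    obtain ⟨c, z, rfl⟩ := centralProd_exists _ _ b
    refine ⟨c⁻¹ * d * c, ?_⟩
    have h := centralInr_commute hG.isUGroup (hG.not_isOfFinOrder hx) z
    rw [map_mul, map_mul, map_inv, ← (h _).eq, mul_inv_rev, mul_assoc _ (centralInr _ _ z)⁻¹,
      mul_assoc, mul_assoc, ← mul_assoc _ (centralInr _ _ z), ((h _).inv_left).eq]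
    rw [mul_assoc (centralEmb _ _ d), inv_mul_cancel, mul_one]

theorem central_inP (hG : InP π G) (hx : LacksRoot π x) (hd : dSet x = (cent x : Set G)) :
    InP π (CentralK hG hx) := by
  have hdata := central_amalgamData hG hx hd
  refine hdata.inP hG (centralProd_isUGroup _ _) (fun d h1 h2 => absurd h1 h2) fun p hp => ?_
  refine hdata.centCond_of_central (fun h => hp.ne_one (by rw [h, map_one])) ?_
    (centralProd_torsionFree _ _ (hG.cond x hx).1)
  have hp' : LacksRoot π p := hp.of_map
  obtain ⟨c, z, rfl⟩ := centralProd_exists _ _ p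
  have hz := centralInr_commute hG.isUGroup (hG.not_isOfFinOrder hx) z
  suffices h : ∀ q : cent x, q * c = c * q by
    intro q
    obtain ⟨r, w, rfl⟩ := centralProd_exists _ _ q
    have hw := centralInr_commute hG.isUGroup (hG.not_isOfFinOrder hx) w
    have hrc : Commute (centralEmb hG.isUGroup (hG.not_isOfFinOrder hx) r) (centralEmb _ _ c) := by
      rw [Commute, SemiconjBy, ← map_mul, h r, map_mul]
    exact (hrc.mul_left (hw _)).mul_right (hz _).symm
  intro q
  by_cases hc1 : (c : G) = 1
  · rw [show c = 1 from Subtype.ext hc1, mul_one, one_mul]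
  by_cases hcr : LacksRoot π (c : G)
  · exact Subtype.ext (central_of_lacksRoot hG hx hd c.2 hcr q.2)
  -- A root of `c ≠ 1` commutes with `c` and so lies in `D = C`; together with a root of `z` in
  -- `ℤ_π` it yields a root of `p`.
  · exfalso
    obtain ⟨m, hm, hr⟩ := hp'
    obtain ⟨y, hy⟩ : ∃ y : G, y ^ m = c := by
      by_contra hno
      exact hcr ⟨m, hm, fun y hy => hno ⟨y, hy⟩⟩
    obtain ⟨w, hw⟩ := localInt_exists_root hm z
    have hyC : y ∈ cent x := by
      have h1 : y * (c : G) * y⁻¹ = c := by rw [← hy, ← pow_succ', pow_succ, mul_inv_cancel_right]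
      have h2 := mem_of_conj_mem_cent (a := y) c.2 hc1 (by rw [h1]; exact c.2)
      rw [hd] at h2
      exact h2
    refine hr (centralEmb _ _ ⟨y, hyC⟩ * centralInr _ _ w) ?_
    rw [(centralInr_commute _ _ w _).symm.mul_pow, ← map_pow, ← map_pow, hw]
    congr 2
    exact Subtype.ext hy

end CentralCase

/-! ### The case `|D : C| = 2`. -/

section Dihedral

variable {π : Set Nat.Primes} {G : Type u} [Group G] {x : G} {D : Subgroup G}

/-- Since `D` contains an involution, squaring is not injective on `G`, so `2` is not in `π'`. -/
theorem IndexTwo.odd_of_isPrimeTo (hU : IsUGroup π G) (h : IndexTwo x D)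
    {i : cent x →* Multiplicative (localInt π)} (hi : Function.Injective i) {m : ℕ}
    (hm : IsPrimeTo π m) : Odd m := by
  rw [← Nat.not_even_iff_odd]
  intro heven
  have h2 : IsPrimeTo π 2 := by
    refine ⟨two_ne_zero, fun p hp => hm.2 p ?_⟩
    exact hp.trans heven.two_dvd
  obtain ⟨d, hd, hdc⟩ := h.exists_notMem
  have h3 : d ^ 2 = 1 ^ 2 := by rw [pow_two, h.mul_self_eq_one hi hd hdc, one_pow]
  rw [hU.eq_of_pow h2 h3] at hdc
  exact hdc (one_mem _)

variable (h : IndexTwo x D) (i : cent x →* Multiplicative (localInt π))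
    (hi : Function.Injective i) (hx : i ⟨x, self_mem_cent x⟩ = Multiplicative.ofAdd 1)

/-- The natural map of `ℤ_π` into the semidirect product over the centralizer. -/
def semidirectInl : Multiplicative (localInt π) →* SemidirectProd h i hi hx :=
  (QuotientGroup.mk' (semidirectKernel h i hi hx)).comp SemidirectProduct.inl

theorem semidirectProd_exists (p : SemidirectProd h i hi hx) :
    ∃ z d, p = semidirectInl h i hi hx z * semidirectEmb h i hi hx d := by
  obtain ⟨q, rfl⟩ := QuotientGroup.mk_surjective p
  refine ⟨q.left, q.right, ?_⟩
  rw [semidirectInl, semidirectEmb, MonoidHom.comp_apply, MonoidHom.comp_apply, ← map_mul,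
    SemidirectProduct.inl_left_mul_inr_right]
  rfl

theorem semidirectInl_eq_emb_iff {z : Multiplicative (localInt π)} {d : D} :
    semidirectInl h i hi hx z = semidirectEmb h i hi hx d ↔
      ∃ hd : (d : G) ∈ cent x, z = i ⟨d, hd⟩ := by
  have h1 : semidirectInl h i hi hx z = semidirectEmb h i hi hx d ↔
      (SemidirectProduct.inl z)⁻¹ * SemidirectProduct.inr d ∈ semidirectKernel h i hi hx :=
    QuotientGroup.eq
  have h2 : (SemidirectProduct.inl z)⁻¹ * SemidirectProduct.inr d =
      (⟨z⁻¹, d⟩ : Multiplicative (localInt π) ⋊[inducedAction h i hi hx] D) := by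
    rw [← map_inv, SemidirectProduct.mk_eq_inl_mul_inr]
  rw [h1, h2]
  constructor
  · rintro ⟨y, hy⟩
    rw [SemidirectProduct.ext_iff] at hy
    obtain ⟨h3, h4⟩ := hy
    simp only at h3 h4
    subst h4
    refine ⟨y.2, ?_⟩
    rw [map_inv, inv_inj] at h3
    exact h3
  · rintro ⟨hd, rfl⟩
    exact ⟨⟨d, hd⟩, by rw [map_inv]⟩

theorem semidirectInl_injective : Function.Injective (semidirectInl h i hi hx) := by
  rw [injective_iff_map_eq_one]
  intro z hz
  rw [← map_one (semidirectEmb h i hi hx), semidirectInl_eq_emb_iff] at hz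
  obtain ⟨hd, rfl⟩ := hz
  exact map_one i

theorem semidirectEmb_injective : Function.Injective (semidirectEmb h i hi hx) := by
  rw [injective_iff_map_eq_one]
  intro d hd
  have h1 := (semidirectInl_eq_emb_iff h i hi hx (z := 1) (d := d)).1 (by rw [hd, map_one])
  obtain ⟨hd', h2⟩ := h1
  rw [← map_one i] at h2
  exact Subtype.ext (congrArg Subtype.val (hi h2)).symm

theorem semidirectEmb_conj (d : D) (z : Multiplicative (localInt π)) :
    semidirectEmb h i hi hx d * semidirectInl h i hi hx z * (semidirectEmb h i hi hx d)⁻¹ =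
      semidirectInl h i hi hx (inducedAction h i hi hx d z) := by
  rw [semidirectInl, semidirectEmb, MonoidHom.comp_apply, MonoidHom.comp_apply,
    MonoidHom.comp_apply, SemidirectProduct.inl_aut, map_mul, map_mul, map_inv, map_inv]

theorem inducedAction_of_notMem {d : D} (hd : (d : G) ∉ cent x)
    (z : Multiplicative (localInt π)) : inducedAction h i hi hx d z = z⁻¹ := by
  have h1 : conjHom h d ⟨x, self_mem_cent x⟩ = (⟨x, self_mem_cent x⟩ : cent x)⁻¹ :=
    Subtype.ext (h.conj_eq_inv hi d.2 hd (self_mem_cent x))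
  have h2 : scaleHom h i hi hx d = -1 := by
    change ringVal i (conjHom h d ⟨x, self_mem_cent x⟩) = -1
    rw [h1, ringVal, map_inv, hx]
    rfl
  rw [inducedAction_def, h2, neg_one_mul]
  rfl

theorem semidirectEmb_mul_inl {d : D} (hd : (d : G) ∉ cent x) (z : Multiplicative (localInt π)) :
    semidirectEmb h i hi hx d * semidirectInl h i hi hx z =
      (semidirectInl h i hi hx z)⁻¹ * semidirectEmb h i hi hx d := by
  rw [← mul_inv_eq_iff_eq_mul, semidirectEmb_conj, inducedAction_of_notMem h i hi hx hd, map_inv]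

theorem semidirectProd_mul_self {d : D} (hd : (d : G) ∉ cent x)
    (z : Multiplicative (localInt π)) :
    (semidirectInl h i hi hx z * semidirectEmb h i hi hx d) ^ 2 = 1 := by
  have h1 : d * d = 1 := Subtype.ext (h.mul_self_eq_one hi d.2 hd)
  rw [pow_two, mul_assoc, ← mul_assoc (semidirectEmb _ _ _ _ d), semidirectEmb_mul_inl h i hi hx hd,
    mul_assoc, ← map_mul, h1, map_one, mul_one, mul_inv_cancel]

/-- Thus `P` is a generalized dihedral group over `ℤ_π`. Odd powers fix its involutions, so roots in
`P` reduce to roots in `ℤ_π`. -/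
theorem semidirectProd_cases (p : SemidirectProd h i hi hx) :
    (∃ z, p = semidirectInl h i hi hx z) ∨
      (p ^ 2 = 1 ∧ ∀ z, p ≠ semidirectInl h i hi hx z) := by
  obtain ⟨z, d, rfl⟩ := semidirectProd_exists h i hi hx p
  by_cases hd : (d : G) ∈ cent x
  · left
    refine ⟨z * i ⟨d, hd⟩, ?_⟩
    rw [map_mul, (semidirectInl_eq_emb_iff h i hi hx (d := d)).2 ⟨hd, rfl⟩]
  · refine Or.inr ⟨semidirectProd_mul_self h i hi hx hd z, fun w hw => ?_⟩
    rw [← eq_inv_mul_iff_mul_eq, ← map_inv, ← map_mul] at hw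
    exact hd ((semidirectInl_eq_emb_iff h i hi hx).1 hw.symm).1

theorem pow_eq_self_of_odd {P : Type*} [Group P] {p : P} (hp : p ^ 2 = 1) {m : ℕ} (hm : Odd m) :
    p ^ m = p := by
  obtain ⟨k, rfl⟩ := hm
  rw [pow_succ, pow_mul, hp, one_pow, one_mul]

theorem semidirectProd_exists_root (hU : IsUGroup π G) {m : ℕ} (hm : IsPrimeTo π m)
    (p : SemidirectProd h i hi hx) : ∃ q, q ^ m = p := by
  rcases semidirectProd_cases h i hi hx p with ⟨z, rfl⟩ | ⟨hp, -⟩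
  · obtain ⟨w, rfl⟩ := localInt_exists_root hm z
    exact ⟨semidirectInl h i hi hx w, (map_pow _ _ _).symm⟩
  · exact ⟨p, pow_eq_self_of_odd hp (h.odd_of_isPrimeTo hU hi hm)⟩

theorem semidirectProd_isUGroup (hU : IsUGroup π G) : IsUGroup π (SemidirectProd h i hi hx) := by
  intro m hm p q hpq
  change p ^ m = q ^ m at hpq
  have hodd := h.odd_of_isPrimeTo hU hi hm
  rcases semidirectProd_cases h i hi hx p with ⟨z, rfl⟩ | ⟨hp, hp'⟩ <;>
    rcases semidirectProd_cases h i hi hx q with ⟨w, rfl⟩ | ⟨hq, hq'⟩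
  · rw [← map_pow, ← map_pow] at hpq
    rw [localInt_pow_injective hm.1 (semidirectInl_injective h i hi hx hpq)]
  · rw [pow_eq_self_of_odd hq hodd, ← map_pow] at hpq
    exact absurd hpq.symm (hq' _)
  · rw [pow_eq_self_of_odd hp hodd, ← map_pow] at hpq
    exact absurd hpq (hp' _)
  · rwa [pow_eq_self_of_odd hp hodd, pow_eq_self_of_odd hq hodd] at hpq

theorem semidirect_amalgamData (hU : IsUGroup π G) (hr : LacksRoot π x) :
    AmalgamData (semidirectEmb h i hi hx) (cent x) where
  injective := semidirectEmb_injective h i hi hx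
  le := h.cent_le
  ne := by
    obtain ⟨m, hm, hr⟩ := hr
    obtain ⟨w, hw⟩ := localInt_exists_root hm (localGen π)
    refine ⟨semidirectInl h i hi hx w, ?_⟩
    rintro ⟨d, hd⟩
    obtain ⟨hdc, rfl⟩ := (semidirectInl_eq_emb_iff h i hi hx).1 hd.symm
    have h1 : (⟨d, hdc⟩ : cent x) ^ m = ⟨x, self_mem_cent x⟩ :=
      hi (by rw [map_pow, hw, hx]; rfl)
    exact hr d (congrArg Subtype.val h1)
  mem_of_conj d b hb hdb := by
    by_contra hd
    obtain ⟨z, t, rfl⟩ := semidirectProd_exists h i hi hx b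
    apply hb
    refine mul_mem ?_ ⟨t, rfl⟩
    set J := semidirectInl h i hi hx
    set E := semidirectEmb h i hi hx
    have h1 : (J z)⁻¹ * E d * J z ∈ E.range := by
      have := mul_mem (mul_mem (⟨t, rfl⟩ : E t ∈ E.range) hdb)
        (inv_mem (⟨t, rfl⟩ : E t ∈ E.range))
      have e1 : E t * ((J z * E t)⁻¹ * E d * (J z * E t)) * (E t)⁻¹ = (J z)⁻¹ * E d * J z := by
        group
      rwa [e1] at this
    -- Since `d` inverts `ℤ_π`, conjugation by `z` changes `d` by the square of `z`.
    have h2 : J (z ^ 2) ∈ E.range := by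
      have h3 : (J z)⁻¹ * E d * J z = J (z ^ 2)⁻¹ * E d := by
        rw [mul_assoc, semidirectEmb_mul_inl h i hi hx hd, map_inv, map_pow]
        change (J z)⁻¹ * ((J z)⁻¹ * E d) = _
        rw [pow_two, mul_inv_rev, mul_assoc]
      rw [h3] at h1
      have h4 := mul_mem h1 (inv_mem (⟨d, rfl⟩ : E d ∈ E.range))
      rw [mul_inv_cancel_right, map_inv, inv_mem_iff] at h4
      exact h4
    -- The denominator `n` of `z` is odd and `z ^ n` is a power of `x`; with `z ^ 2` this gives `z`
    -- itself.
    obtain ⟨n, hn, a, ha⟩ := localInt_exists_pow z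
    obtain ⟨k, hk⟩ := h.odd_of_isPrimeTo hU hi hn
    have h5 : J (z ^ n) ∈ E.range := by
      rw [ha, map_zpow]
      refine E.range.zpow_mem ⟨⟨x, h.cent_le (self_mem_cent x)⟩, ?_⟩ a
      exact ((semidirectInl_eq_emb_iff h i hi hx).2 ⟨self_mem_cent x, hx.symm⟩).symm
    have h6 : z = z ^ n * ((z ^ 2) ^ k)⁻¹ := by
      rw [hk, pow_succ', pow_mul, mul_inv_cancel_right]
    rw [h6, map_mul, map_inv, map_pow J (z ^ 2)]
    exact mul_mem h5 (inv_mem (pow_mem h2 k))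
  eq_one_of_conj c hc a ha hac := by
    by_contra hc1
    by_cases h1 : a * c * a⁻¹ ∈ cent x
    · have h2 := mem_of_conj_mem_cent hc hc1 h1
      rw [← h.coe_eq] at h2
      exact ha h2
    -- Outside `C` the conjugate would be an involution, while `C` is torsion-free.
    · have h2 := h.mul_self_eq_one hi hac h1
      refine hc1 (pow_eq_one_of_injective hi hc two_ne_zero ?_)
      have h3 : c ^ 2 = a⁻¹ * (a * c * a⁻¹ * (a * c * a⁻¹)) * a := by rw [pow_two]; group
      rw [h3, h2]
      group
  normal d hd b := by
    obtain ⟨z, t, rfl⟩ := semidirectProd_exists h i hi hx b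
    have h1 := (semidirectInl_eq_emb_iff h i hi hx (d := d)).2 ⟨hd, rfl⟩
    set J := semidirectInl h i hi hx
    set E := semidirectEmb h i hi hx
    refine ⟨t⁻¹ * d * t, ?_⟩
    have h2 : (J z)⁻¹ * E d * J z = E d := by
      rw [← h1, ← map_inv, ← map_mul, ← map_mul, mul_comm z⁻¹, inv_mul_cancel_right]
    rw [map_mul, map_mul, map_inv]
    nth_rewrite 1 [← h2]
    group

theorem semidirect_inP (hG : InP π G) (hr : LacksRoot π x) :
    InP π (SemidirectK h i hi hx) := by
  refine (semidirect_amalgamData h i hi hx hG.isUGroup hr).inP hG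
    (semidirectProd_isUGroup h i hi hx hG.isUGroup) (fun d hd hdc => ?_) fun p hp => ?_
  · refine isOfFinOrder_iff_pow_eq_one.2 ⟨2, two_pos, ?_⟩
    rw [pow_two, h.mul_self_eq_one hi hd hdc]
  · obtain ⟨m, hm, hno⟩ := hp.of_map
    obtain ⟨q, hq⟩ := semidirectProd_exists_root h i hi hx hG.isUGroup hm p
    exact absurd hq (hno q)

end Dihedral

/-! ### Normalizing the embedding of `C` so that `1` is attained. -/

section Generator

variable {π : Set Nat.Primes} {G : Type u} [Group G] {x : G} {D : Subgroup G}

/-- A subgroup of `ℤ_π` has an embedding into `ℤ_π` whose image contains `1`. -/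
theorem exists_embedding_hitting_one {C : Type u} [Group C]
    (i : C →* Multiplicative (localInt π)) (hi : Function.Injective i) [Nontrivial C] :
    ∃ (j : C →* Multiplicative (localInt π)) (c : C), Function.Injective j ∧
      j c = localGen π := by
  -- The integers in the image of `i` form a subgroup with generator `g`, and the required embedding
  -- is `i` divided by `g`. This stays in `ℤ_π`, since `g` divides the numerator of every element of
  -- the image.
  let H : AddSubgroup ℤ :=
    { carrier := {n | ∃ c, i c = localGen π ^ n}
      zero_mem' := ⟨1, by simp⟩
      add_mem' := by
        rintro m n ⟨c, hc⟩ ⟨d, hd⟩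
        exact ⟨c * d, by rw [map_mul, hc, hd, zpow_add]⟩
      neg_mem' := by
        rintro m ⟨c, hc⟩
        exact ⟨c⁻¹, by rw [map_inv, hc, zpow_neg]⟩ }
  obtain ⟨g, hg⟩ := Int.subgroup_cyclic H
  have hmem : ∀ n c, i c = localGen π ^ n → ∃ k : ℤ, n = k * g := by
    intro n c hc
    have h1 : n ∈ H := ⟨c, hc⟩
    rw [hg, AddSubgroup.mem_closure_singleton] at h1
    obtain ⟨k, hk⟩ := h1
    exact ⟨k, by rw [← hk, smul_eq_mul]⟩
  obtain ⟨c₀, hc₀⟩ : ∃ c, i c = localGen π ^ g := by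
    have : g ∈ H := by rw [hg]; exact AddSubgroup.mem_closure_singleton_self g
    exact this
  have hexp : ∀ c, ∃ z : Multiplicative (localInt π), z ^ g = i c := by
    intro c
    obtain ⟨b, hb, a, ha⟩ := localInt_exists_pow (i c)
    obtain ⟨k, rfl⟩ := hmem a (c ^ b) (by rw [map_pow, ha])
    obtain ⟨z, hz⟩ := localInt_exists_root hb (localGen π ^ k)
    refine ⟨z, localInt_pow_injective hb.1 ?_⟩
    rw [ha, ← zpow_natCast, ← zpow_mul, mul_comm, zpow_mul, zpow_natCast, hz, ← zpow_mul]
  have hg0 : g ≠ 0 := by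
    rintro rfl
    obtain ⟨c, hc⟩ := exists_ne (1 : C)
    obtain ⟨z, hz⟩ := hexp c
    rw [zpow_zero, ← map_one i] at hz
    exact hc (hi hz).symm
  choose j hj using hexp
  refine ⟨MonoidHom.mk' j fun c d => localInt_zpow_injective hg0 ?_, c₀, fun c d hcd => hi ?_,
    localInt_zpow_injective hg0 ?_⟩
  · rw [mul_zpow, hj, hj, hj, map_mul]
  · rw [← hj, ← hj]
    exact congrArg (· ^ g) hcd
  · rw [← hc₀]
    exact hj c₀

theorem IndexTwo.exists_generator (hG : InP π G) (hx : LacksRoot π x) (hD : IndexTwo x D) :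
    ∃ x₀ : G, LacksRoot π x₀ ∧ cent x₀ = cent x ∧
      ∃ i : cent x₀ →* Multiplicative (localInt π), Function.Injective i ∧
        i ⟨x₀, self_mem_cent x₀⟩ = Multiplicative.ofAdd 1 := by
  obtain ⟨i', hi'⟩ : ∃ i : cent x →* Multiplicative (localInt π), Function.Injective i := by
    rcases (hG.cond x hx).2 with h | h
    · obtain ⟨d, hd, hdc⟩ := hD.exists_notMem
      have h1 : d ∈ (D : Set G) := hd
      rw [hD.coe_eq, h] at h1
      exact absurd h1 hdc
    · exact h.2
  have hnt : Nontrivial (cent x) :=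
    ⟨⟨⟨x, self_mem_cent x⟩, 1, fun e => hx.ne_one (congrArg Subtype.val e)⟩⟩
  obtain ⟨i, ⟨x₀, hx₀⟩, hi, hix⟩ := exists_embedding_hitting_one i' hi'
  have hx₀1 : x₀ ≠ 1 := by
    rintro rfl
    exact localGen_ne_one (hix.symm.trans (map_one i))
  have hcent : cent x₀ = cent x := by
    ext k
    constructor
    · intro hk
      by_contra hkc
      have h1 : k * x₀ * k⁻¹ = x₀ := by rw [mem_cent_iff.1 hk, mul_inv_cancel_right]
      -- An element of `cent x₀` lies in `D`; outside `cent x` it would invert `x₀` as well as fix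
      -- it.
      have h2 := mem_of_conj_mem_cent (a := k) hx₀ hx₀1 (by rwa [h1])
      rw [← hD.coe_eq] at h2
      have h3 := hD.conj_eq_inv hi h2 hkc hx₀
      rw [h1] at h3
      refine hx₀1 (pow_eq_one_of_injective hi hx₀ two_ne_zero ?_)
      rw [pow_two]
      nth_rewrite 1 [h3]
      rw [inv_mul_cancel]
    · exact fun hk => mem_cent_iff.2 (commute_of_injective hi hk hx₀)
  refine ⟨x₀, ?_, hcent, i.comp (MulEquiv.subgroupCongr hcent).toMonoidHom,
    hi.comp (MulEquiv.subgroupCongr hcent).injective, hix⟩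
  obtain ⟨m, hm, hno⟩ := hx
  obtain ⟨b, hb, a, ha⟩ := localInt_exists_pow (i ⟨x, self_mem_cent x⟩)
  -- As `x ^ b = x₀ ^ a`, a root `y` of `x₀` of order `b * m` would make `y ^ a` an `m`-th root of
  -- `x`.
  refine ⟨b * m, hb.mul hm, fun y hy => hno (y ^ a) (hG.isUGroup.eq_of_pow hb ?_)⟩
  have h1 : (⟨x, self_mem_cent x⟩ : cent x) ^ b = ⟨x₀, hx₀⟩ ^ a :=
    hi (by rw [map_pow, map_zpow, ha, hix])
  have h2 : x ^ b = x₀ ^ a := congrArg Subtype.val h1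
  rw [h2, ← hy, ← pow_mul, ← zpow_natCast, ← zpow_natCast, ← zpow_mul, ← zpow_mul, mul_comm b,
    mul_comm a]

end Generator

end PiLocal

theorem theorem2p4 {G : Type u} [Group G] (π : Set Nat.Primes) (hG : PiLocal.InP π G)
    (x : G) (hx : PiLocal.LacksRoot π x) :
    (PiLocal.dSet x = (PiLocal.cent x : Set G) → PiLocal.InP π (PiLocal.CentralK hG hx)) ∧
    (∀ (D : Subgroup G) (hD : PiLocal.IndexTwo x D),
      (∃ x₀ : G, PiLocal.LacksRoot π x₀ ∧ PiLocal.cent x₀ = PiLocal.cent x ∧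
        ∃ i : PiLocal.cent x₀ →* Multiplicative (PiLocal.localInt π), Function.Injective i ∧
          i ⟨x₀, PiLocal.self_mem_cent x₀⟩ = Multiplicative.ofAdd 1) ∧
      ∀ (i : PiLocal.cent x →* Multiplicative (PiLocal.localInt π)) (hi : Function.Injective i)
        (hix : i ⟨x, PiLocal.self_mem_cent x⟩ = Multiplicative.ofAdd 1),
        PiLocal.InP π (PiLocal.SemidirectK hD i hi hix)) :=
  ⟨PiLocal.central_inP hG hx, fun _ hD => ⟨hD.exists_generator hG hx,
    fun i hi hix => PiLocal.semidirect_inP hD i hi hix hG hx⟩⟩
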